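/- Let $(X,\mathcal X,\mu)$ be a probability space and let $T_1,T_2\colon X\to X$ be invertible measure-preserving transformations (with measurable inverses) that commute $\mu$-almost everywhere. Write $\mathbb E_{n\in[N]}:=\frac1N\sum_{n=1}^N$, and $S f:=f\circ S$ for a transformation $S$. Put $b(n):=n+\lfloor\log_2 n\rfloor$ for $n\ge 1$. Then the following two properties (A) and (B) are equivalent. (A) The pair $(T_1^{n},T_2^{b(n)})_n$ is both weakly difference ergodic and strongly product ergodic, that is: * (weak difference ergodicity) for every $f\in L^\infty(\mu)$, both $$\mathbb E_{n\in[N]}\,T_1^{n}T_2^{-b(n)}f\quad\text{and}\quad \mathbb E_{n\in[N]}\,T_2^{b(n)}T_1^{-n}f$$ converge to $\int f\,d\mu$ weakly in $L^2(\mu)$ as $N\to\infty$; * (strong product ergodicity) for every $F\in L^\infty(\mu\times\mu)$, $$\lim_{N\to\infty}\Bigl\|\mathbb E_{n\in[N]}\,(T_1^{n}\times T_2^{b(n)})F-\int F\,d(\mu\times\mu)\Bigr\|_{L^2(\mu\times\mu)}=0.$$ (B) The pair is strongly jointly ergodic: for all $f_1,f_2\in L^\infty(\mu)$, $$\lim_{N\to\infty}\Bigl\|\mathbb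 E_{n\in[N]}\,T_1^{n}f_1\cdot T_2^{b(n)}f_2-\int f_1\,d\mu\int f_2\,d\mu\Bigr\|_{L^2(\mu)}=0.$$ -/

import Mathlib

open MeasureTheory Filter Topology

/-- The `k`-th iterate (`k : ℤ`) of an invertible bi-measurable transformation, as a map. -/
def transIter {X : Type*} [MeasurableSpace X] (T : X ≃ᵐ X) (k : ℤ) : X → X :=
  ⇑((T.toEquiv : Equiv.Perm X) ^ k)

/-- The Cesàro average `𝔼_{n ∈ [N]} u n = (1 / N) ∑_{n = 1}^{N} u n` of a sequence of functions. -/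
noncomputable def cesaroAvg {X : Type*} (u : ℕ → X → ℂ) (N : ℕ) (x : X) : ℂ :=
  (1 / (N : ℂ)) * ∑ n ∈ Finset.Icc 1 N, u n x

/-- The functions `F N` converge to the constant `c` in the norm of `L²(μ)`. -/
def StrongLimit {X : Type*} [MeasurableSpace X] (μ : Measure X) (F : ℕ → X → ℂ) (c : ℂ) : Prop :=
  Tendsto (fun N => eLpNorm (fun x => F N x - c) 2 μ) atTop (𝓝 0)

/-- The functions `F N` converge to the constant `c` weakly in `L²(μ)`
(meant for functions `F N` in `L²(μ)`). -/
def WeakLimit {X : Type*} [MeasurableSpace X] (μ : Measure X) (F : ℕ → X → ℂ) (c : ℂ) : Prop :=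
  ∀ g : X → ℂ, MemLp g 2 μ →
    Tendsto (fun N => ∫ x, g x * F N x ∂μ) atTop (𝓝 (∫ x, g x * c ∂μ))

/-- A sequence `S` of measure preserving transformations is strongly ergodic: for all
`f ∈ L^∞(μ)`, `𝔼_{n ∈ [N]} f ∘ S n` converges to `∫ f dμ` in the norm of `L²(μ)`. -/
def StronglyErgodicSeq {X : Type*} [MeasurableSpace X] (μ : Measure X) (S : ℕ → X → X) : Prop :=
  ∀ f : X → ℂ, MemLp f ⊤ μ →
    StrongLimit μ (cesaroAvg fun n x => f (S n x)) (∫ x, f x ∂μ)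

/-- A sequence `S` of measure preserving transformations is weakly ergodic: for all
`f ∈ L^∞(μ)`, `𝔼_{n ∈ [N]} f ∘ S n` converges to `∫ f dμ` weakly in `L²(μ)`. -/
def WeaklyErgodicSeq {X : Type*} [MeasurableSpace X] (μ : Measure X) (S : ℕ → X → X) : Prop :=
  ∀ f : X → ℂ, MemLp f ⊤ μ →
    WeakLimit μ (cesaroAvg fun n x => f (S n x)) (∫ x, f x ∂μ)

/-- Strong joint ergodicity (SJ) of `a 0, …, a (ℓ - 1)` for the system `(X, μ, T)`. -/
def StronglyJointlyErgodic {X : Type*} [MeasurableSpace X] {ℓ : ℕ} (μ : Measure X)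
    (T : Fin ℓ → X ≃ᵐ X) (a : Fin ℓ → ℕ → ℝ) : Prop :=
  ∀ f : Fin ℓ → X → ℂ, (∀ j, MemLp (f j) ⊤ μ) →
    StrongLimit μ (cesaroAvg fun n x => ∏ j, f j (transIter (T j) ⌊a j n⌋ x))
      (∏ j, ∫ x, f j x ∂μ)

/-- Weak difference ergodicity (WD): the sequence `T_i ^ ⌊a_i(n)⌋ T_j ^ (-⌊a_j(n)⌋)` is
weakly ergodic on `(X, μ)` for all distinct `i, j`. -/
def WeaklyDifferenceErgodic {X : Type*} [MeasurableSpace X] {ℓ : ℕ} (μ : Measure X)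
    (T : Fin ℓ → X ≃ᵐ X) (a : Fin ℓ → ℕ → ℝ) : Prop :=
  ∀ i j : Fin ℓ, i ≠ j →
    WeaklyErgodicSeq μ fun n x => transIter (T i) ⌊a i n⌋ (transIter (T j) (-⌊a j n⌋) x)

/-- Strong product ergodicity (SP): the sequence `T_1 ^ ⌊a_1(n)⌋ × ⋯ × T_ℓ ^ ⌊a_ℓ(n)⌋` is
strongly ergodic on the product probability space `(X ^ ℓ, μ ^ ℓ)`. -/
def StronglyProductErgodic {X : Type*} [MeasurableSpace X] {ℓ : ℕ} (μ : Measure X)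
    (T : Fin ℓ → X ≃ᵐ X) (a : Fin ℓ → ℕ → ℝ) : Prop :=
  StronglyErgodicSeq (Measure.pi fun _ : Fin ℓ => μ)
    fun n x j => transIter (T j) ⌊a j n⌋ (x j)

/-! The function `log₂ n` is constant on the dyadic blocks `[2^k, 2^(k+1))`. Its jumps are so rare
that replacing `log₂ (n + h)` by `log₂ n` does not change Cesàro limits, yet each block is long
enough to be seen by the averages.

Put `S = T₁ × T₂` and `V = id × T₂`, so that `T₁ⁿ × T₂^b(n) = Sⁿ V^(log₂ n)`. Strong product
ergodicity is then equivalent to ergodicity of `S`. Coboundaries of `S` average to zero because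
jumps are rare (`tendsto_cesaroMean_log_of_invariant`). Conversely, on an `S`-invariant vector only
`V^(log₂ n)` acts, and averages of a function of `log₂ n` can tend to zero only if its block values
do (`eq_of_tendsto_cesaroMean_log`).

(A) ⇒ (B) is a van der Corput argument with `log₂` frozen under shifts. By weak difference
ergodicity the correlations of `T₁ⁿ f₁ · T₂^b(n) f₂` converge to those of the orbit of `f₁ ⊗ f₂`
under `S`, whose averages vanish by ergodicity of `S` when the product of the integrals is zero.

(B) ⇒ (A): integrating the joint averages and changing variables gives weak difference ergodicity.
If `S` were not ergodic, Wiener's lemma applied to the spectral measures would give eigenvalues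
`c⁻¹` of `T₁` and `c` of `T₂`, with `c ≠ 1` because both maps are ergodic. The corresponding joint
terms are `c^(log₂ n) e₁ e₂`, which are constant on blocks and have constant nonzero modulus, so
they cannot average to zero (`eq_one_of_eigenvectors`). -/

/-! ### Cesàro means and slowly varying sequences. -/

section CesaroMeans

variable {E : Type*} [NormedAddCommGroup E] [InnerProductSpace ℂ E]

/-- The Cesàro mean `(1 / N) ∑_{n = 1}^{N} u n` of a sequence of vectors. -/
noncomputable def cesaroMean (u : ℕ → E) (N : ℕ) : E :=
  (N : ℂ)⁻¹ • ∑ n ∈ Finset.Icc 1 N, u n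

lemma norm_cesaroMean_le_avg (u : ℕ → E) (N : ℕ) :
    ‖cesaroMean u N‖ ≤ (N : ℝ)⁻¹ * ∑ n ∈ Finset.Icc 1 N, ‖u n‖ := by
  unfold cesaroMean
  rw [norm_smul, norm_inv, Complex.norm_natCast]
  gcongr
  exact norm_sum_le _ _

lemma avg_le {f : ℕ → ℝ} {C : ℝ} (hC : 0 ≤ C) (h : ∀ n, f n ≤ C) (N : ℕ) :
    (N : ℝ)⁻¹ * ∑ n ∈ Finset.Icc 1 N, f n ≤ C := by
  rcases Nat.eq_zero_or_pos N with rfl | hN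
  · simpa using hC
  have : ∑ n ∈ Finset.Icc 1 N, f n ≤ N * C := by
    refine (Finset.sum_le_sum fun n _ => h n).trans ?_
    simp
  have hN' : (0 : ℝ) < N := by exact_mod_cast hN
  rw [inv_mul_le_iff₀ hN']
  exact this

lemma norm_cesaroMean_le {u : ℕ → E} {C : ℝ} (h : ∀ n, ‖u n‖ ≤ C) (N : ℕ) :
    ‖cesaroMean u N‖ ≤ C :=
  (norm_cesaroMean_le_avg u N).trans (avg_le ((norm_nonneg _).trans (h 0)) h N)

lemma cesaroMean_add (u v : ℕ → E) (N : ℕ) :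
    cesaroMean (fun n => u n + v n) N = cesaroMean u N + cesaroMean v N := by
  simp [cesaroMean, Finset.sum_add_distrib, smul_add]

lemma cesaroMean_sub (u v : ℕ → E) (N : ℕ) :
    cesaroMean (fun n => u n - v n) N = cesaroMean u N - cesaroMean v N := by
  simp [cesaroMean, Finset.sum_sub_distrib, smul_sub]

lemma cesaroMean_smul (c : ℂ) (u : ℕ → E) (N : ℕ) :
    cesaroMean (fun n => c • u n) N = c • cesaroMean u N := by
  simp [cesaroMean, ← Finset.smul_sum, smul_comm c]

lemma cesaroMean_sum {ι : Type*} (s : Finset ι) (u : ι → ℕ → E) (N : ℕ) :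
    cesaroMean (fun n => ∑ i ∈ s, u i n) N = ∑ i ∈ s, cesaroMean (u i) N := by
  simp only [cesaroMean]
  rw [Finset.sum_comm, Finset.smul_sum]

lemma cesaroMean_const (x : E) {N : ℕ} (hN : N ≠ 0) : cesaroMean (fun _ => x) N = x := by
  have : (N : ℂ) ≠ 0 := by exact_mod_cast hN
  simp [cesaroMean, ← Nat.cast_smul_eq_nsmul ℂ, smul_smul, this]

lemma tendsto_cesaroMean_const (x : E) : Tendsto (cesaroMean fun _ => x) atTop (𝓝 x) := by
  refine tendsto_const_nhds.congr' ?_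
  filter_upwards [eventually_ne_atTop 0] with N hN
  rw [cesaroMean_const x hN]

lemma map_cesaroMean {F : Type*} [NormedAddCommGroup F] [InnerProductSpace ℂ F] (L : E →L[ℂ] F)
    (u : ℕ → E) (N : ℕ) : L (cesaroMean u N) = cesaroMean (fun n => L (u n)) N := by
  simp [cesaroMean]

lemma tendsto_inv_mul_log (h : ℕ) :
    Tendsto (fun N : ℕ => (N : ℝ)⁻¹ * (Nat.log 2 (N + h) : ℝ)) atTop (𝓝 0) := by
  have h1 : Tendsto (fun N : ℕ => Real.log N / N) atTop (𝓝 0) :=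
    (Real.isLittleO_log_id_atTop.tendsto_div_nhds_zero).comp tendsto_natCast_atTop_atTop
  have h2 : Tendsto (fun N : ℕ => (N : ℝ)⁻¹) atTop (𝓝 0) := tendsto_inv_atTop_nhds_zero_nat
  have h3 := (h1.const_mul (Real.log 2)⁻¹).add (h2.const_mul (h : ℝ))
  simp only [mul_zero, add_zero] at h3
  refine squeeze_zero' (Eventually.of_forall fun N => by positivity) ?_ h3
  filter_upwards [eventually_ge_atTop 1] with N hN
  have hlog : Nat.log 2 (N + h) ≤ Nat.log 2 N + h := by
    have : N + h ≤ N * 2 ^ h := by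
      have := Nat.lt_two_pow_self (n := h)
      nlinarith
    have hmul : ∀ k, Nat.log 2 (N * 2 ^ k) = Nat.log 2 N + k := fun k => by
      induction k with
      | zero => simp
      | succ k ih =>
        rw [pow_succ, ← mul_assoc, Nat.log_mul_base (by norm_num) (by positivity), ih, add_assoc]
    exact (Nat.log_mono_right this).trans (hmul h).le
  have hlog2 : (Nat.log 2 N : ℝ) ≤ (Real.log 2)⁻¹ * Real.log N := by
    have := Real.natLog_le_logb N 2
    rw [Real.logb, div_eq_inv_mul] at this
    exact_mod_cast this
  calc (N : ℝ)⁻¹ * (Nat.log 2 (N + h) : ℝ)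
      ≤ (N : ℝ)⁻¹ * ((Nat.log 2 N : ℝ) + h) := by
        gcongr
        exact_mod_cast hlog
    _ ≤ (N : ℝ)⁻¹ * ((Real.log 2)⁻¹ * Real.log N + h) := by gcongr
    _ = _ := by ring

/-- For each unit shift the sum telescopes to at most `log₂ (N + h)`. As the summand is at least `1`
whenever `log₂` jumps between `n` and `n + h`, this bounds the number of such `n`. -/
lemma sum_log_shift_le (h N : ℕ) :
    ∑ n ∈ Finset.Icc 1 N, ((Nat.log 2 (n + h) : ℝ) - Nat.log 2 n) ≤ h * Nat.log 2 (N + h) := by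
  induction h with
  | zero => simp
  | succ k ih =>
    have tel : ∀ M : ℕ, ∑ n ∈ Finset.Icc 1 M,
        ((Nat.log 2 (n + (k + 1)) : ℝ) - Nat.log 2 (n + k)) ≤ Nat.log 2 (M + (k + 1)) := by
      intro M
      induction M with
      | zero => simp
      | succ m ihm =>
        rw [Finset.sum_Icc_succ_top (by omega)]
        have : m + 1 + k = m + (k + 1) := by ring
        rw [this]
        linarith
    have hmono : (Nat.log 2 (N + k) : ℝ) ≤ Nat.log 2 (N + (k + 1)) := by
      exact_mod_cast Nat.log_mono_right (by omega)
    have hsplit : ∑ n ∈ Finset.Icc 1 N, ((Nat.log 2 (n + (k + 1)) : ℝ) - Nat.log 2 n)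
        = ∑ n ∈ Finset.Icc 1 N, ((Nat.log 2 (n + (k + 1)) : ℝ) - Nat.log 2 (n + k))
          + ∑ n ∈ Finset.Icc 1 N, ((Nat.log 2 (n + k) : ℝ) - Nat.log 2 n) := by
      rw [← Finset.sum_add_distrib]
      exact Finset.sum_congr rfl fun n _ => by ring
    have := tel N
    have h4 : (k : ℝ) * Nat.log 2 (N + k) ≤ k * Nat.log 2 (N + (k + 1)) := by gcongr
    rw [hsplit]
    push_cast at *
    linarith

/-- A sequence supported near the jumps of `Nat.log 2` has vanishing Cesàro means. -/
lemma tendsto_cesaroMean_zero_of_le_log_shift {d : ℕ → E} {C : ℝ} (hC : 0 ≤ C) (h : ℕ)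
    (hd : ∀ n, 1 ≤ n → ‖d n‖ ≤ C * ((Nat.log 2 (n + h) : ℝ) - Nat.log 2 n)) :
    Tendsto (cesaroMean d) atTop (𝓝 0) := by
  have h1 := (tendsto_inv_mul_log h).const_mul (C * h)
  rw [mul_zero] at h1
  refine squeeze_zero_norm (fun N => ?_) h1
  calc ‖cesaroMean d N‖ ≤ (N : ℝ)⁻¹ * ∑ n ∈ Finset.Icc 1 N, ‖d n‖ := norm_cesaroMean_le_avg d N
    _ ≤ (N : ℝ)⁻¹ * ∑ n ∈ Finset.Icc 1 N, C * ((Nat.log 2 (n + h) : ℝ) - Nat.log 2 n) := by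
        gcongr with n hn
        exact hd n (Finset.mem_Icc.1 hn).1
    _ ≤ (N : ℝ)⁻¹ * (C * (h * Nat.log 2 (N + h))) := by
        rw [← Finset.mul_sum]
        gcongr
        exact sum_log_shift_le h N
    _ = C * h * ((N : ℝ)⁻¹ * Nat.log 2 (N + h)) := by ring

/-- Unit shifts telescope, so only boundary terms of total norm at most `2hC` survive. -/
lemma tendsto_cesaroMean_shift {u : ℕ → E} {C : ℝ} (hu : ∀ n, ‖u n‖ ≤ C) (h : ℕ) :
    Tendsto (cesaroMean fun n => u (n + h) - u n) atTop (𝓝 0) := by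
  have hC : 0 ≤ C := (norm_nonneg _).trans (hu 0)
  have h1 : Tendsto (fun N : ℕ => (N : ℝ)⁻¹ * (2 * h * C)) atTop (𝓝 0) := by
    simpa using (tendsto_inv_atTop_nhds_zero_nat (𝕜 := ℝ)).mul_const (2 * h * C)
  refine squeeze_zero_norm (fun N => ?_) h1
  have key : ∀ h : ℕ, ‖∑ n ∈ Finset.Icc 1 N, (u (n + h) - u n)‖ ≤ 2 * h * C := by
    intro h
    induction h with
    | zero => simp
    | succ k ih =>
      have hsplit : ∑ n ∈ Finset.Icc 1 N, (u (n + (k + 1)) - u n)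
          = ∑ n ∈ Finset.Icc 1 N, (u (n + (k + 1)) - u (n + k))
            + ∑ n ∈ Finset.Icc 1 N, (u (n + k) - u n) := by
        rw [← Finset.sum_add_distrib]
        exact Finset.sum_congr rfl fun n _ => by abel
      have tel : ∀ M : ℕ, ∑ n ∈ Finset.Icc 1 M, (u (n + (k + 1)) - u (n + k))
          = u (M + (k + 1)) - u (k + 1) := by
        intro M
        induction M with
        | zero => simp
        | succ m ihm =>
          rw [Finset.sum_Icc_succ_top (by omega), ihm, show m + 1 + k = m + (k + 1) by ring]
          abel
      rw [hsplit, tel]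
      calc _ ≤ (‖u (N + (k + 1))‖ + ‖u (k + 1)‖) + 2 * k * C :=
            (norm_add_le _ _).trans (add_le_add (norm_sub_le _ _) ih)
        _ ≤ (C + C) + 2 * k * C := by gcongr <;> apply hu
        _ = _ := by push_cast; ring
  rw [cesaroMean, norm_smul, norm_inv, Complex.norm_natCast]
  gcongr
  exact key h

/-- If the Cesàro means along the dyadic blocks tend to zero, so do the block values. -/
lemma tendsto_zero_of_cesaroMean_log {v : ℕ → E}
    (hv : Tendsto (cesaroMean fun n => v (Nat.log 2 n)) atTop (𝓝 0)) :
    Tendsto v atTop (𝓝 0) := by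
  rw [Metric.tendsto_atTop] at hv ⊢
  intro ε hε
  -- The block of `k` has `2^k` terms, all equal to `v k`, and is the difference of two initial sums
  -- of total length at most `3 * 2^k`. Hence `‖v k‖ ≤ 3ε/4`.
  obtain ⟨N₀, hN₀⟩ := hv (ε / 4) (by positivity)
  have bound : ∀ N, N₀ ≤ N → ‖∑ n ∈ Finset.Icc 1 N, v (Nat.log 2 n)‖ ≤ N * (ε / 4) := by
    intro N hN
    have := (hN₀ N hN).le
    rw [dist_zero_right, cesaroMean, norm_smul, norm_inv, Complex.norm_natCast] at this
    rcases Nat.eq_zero_or_pos N with rfl | hp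
    · simp
    · have hN' : (0 : ℝ) < N := by exact_mod_cast hp
      rwa [inv_mul_le_iff₀ hN'] at this
  refine ⟨N₀ + 1, fun k hk => ?_⟩
  have hk2 : k < 2 ^ k := Nat.lt_two_pow_self
  have hsum : ∑ n ∈ Finset.Icc 1 (2 ^ (k + 1) - 1), v (Nat.log 2 n)
      = ∑ n ∈ Finset.Icc 1 (2 ^ k - 1), v (Nat.log 2 n) + (2 ^ k : ℕ) • v k := by
    have hpow : 2 ^ (k + 1) = 2 ^ k + 2 ^ k := by ring
    have e1 : ∀ m : ℕ, 1 ≤ m → Finset.Icc 1 (m - 1) = Finset.Ico 1 m := fun m hm => by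
      ext; simp; omega
    rw [e1 _ Nat.one_le_two_pow, e1 _ Nat.one_le_two_pow,
      ← Finset.sum_Ico_consecutive _ Nat.one_le_two_pow (by omega : 2 ^ k ≤ 2 ^ (k + 1))]
    congr 1
    rw [Finset.sum_congr rfl (g := fun _ => v k)]
    · simp [hpow]
    · intro n hn
      rw [Finset.mem_Ico] at hn
      rw [Nat.log_eq_of_pow_le_of_lt_pow hn.1 hn.2]
  have b1 := bound (2 ^ (k + 1) - 1) (by have : 2 ^ (k + 1) = 2 ^ k + 2 ^ k := by ring
                                         omega)
  have b2 := bound (2 ^ k - 1) (by omega)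
  have c1 : ((2 ^ (k + 1) - 1 : ℕ) : ℝ) ≤ 2 * 2 ^ k := by
    have : ((2 ^ (k + 1) - 1 : ℕ) : ℝ) ≤ ((2 ^ (k + 1) : ℕ) : ℝ) := by
      exact_mod_cast Nat.sub_le _ _
    refine this.trans (le_of_eq ?_)
    push_cast; ring
  have c2 : ((2 ^ k - 1 : ℕ) : ℝ) ≤ 2 ^ k := by
    have : ((2 ^ k - 1 : ℕ) : ℝ) ≤ ((2 ^ k : ℕ) : ℝ) := by
      exact_mod_cast Nat.sub_le _ _
    exact_mod_cast this
  have hv' : ‖(2 ^ k : ℕ) • v k‖ ≤ 3 * 2 ^ k * (ε / 4) := by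
    rw [eq_sub_of_add_eq' hsum.symm]
    refine (norm_sub_le _ _).trans ((add_le_add b1 b2).trans ?_)
    nlinarith
  rw [← Nat.cast_smul_eq_nsmul ℂ, norm_smul, Complex.norm_natCast] at hv'
  push_cast at hv'
  have hp : (0 : ℝ) < 2 ^ k := by positivity
  rw [dist_zero_right]
  have : (2 : ℝ) ^ k * ‖v k‖ < 2 ^ k * ε := by nlinarith
  exact lt_of_mul_lt_mul_left this hp.le

omit [InnerProductSpace ℂ E] in
/-- The set of vectors at which a bounded sequence of operators converges to a given operator is
closed. -/
lemma isClosed_setOf_tendsto_clm {F : Type*} [NormedAddCommGroup F] [InnerProductSpace ℂ F]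
    {L : ℕ → E → F} {M : E → F} {C : ℝ} (hL : ∀ N x y, ‖L N x - L N y‖ ≤ C * ‖x - y‖)
    (hM : Continuous M) :
    IsClosed {x : E | Tendsto (fun N => L N x) atTop (𝓝 (M x))} := by
  refine isClosed_of_closure_subset fun x hx => ?_
  rw [Set.mem_ofPred_eq, Metric.tendsto_atTop]
  intro ε hε
  obtain ⟨δ, hδ, hMδ⟩ := Metric.continuous_iff.1 hM x (ε / 3) (by positivity)
  -- `|C| + 1` keeps the denominator positive whatever the sign of `C`.
  obtain ⟨y, hy, hxy⟩ := Metric.mem_closure_iff.1 hx (min δ (ε / (3 * (|C| + 1)))) (by positivity)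
  obtain ⟨N₀, hN₀⟩ := Metric.tendsto_atTop.1 hy (ε / 3) (by positivity)
  refine ⟨N₀, fun N hN => ?_⟩
  have h1 : dist (L N x) (L N y) ≤ ε / 3 := by
    rw [dist_eq_norm]
    have h2 : ‖x - y‖ ≤ ε / (3 * (|C| + 1)) := by
      rw [← dist_eq_norm]; exact (hxy.trans_le (min_le_right _ _)).le
    calc ‖L N x - L N y‖ ≤ C * ‖x - y‖ := hL N x y
      _ ≤ (|C| + 1) * (ε / (3 * (|C| + 1))) := by
          gcongr
          linarith [le_abs_self C]
      _ = ε / 3 := by field_simp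
  have h3 : dist (M y) (M x) < ε / 3 := hMδ y (by
    rw [dist_comm]; exact hxy.trans_le (min_le_left _ _))
  calc dist (L N x) (M x) ≤ dist (L N x) (L N y) + dist (L N y) (M y) + dist (M y) (M x) :=
        dist_triangle4 _ _ _ _
    _ < ε := by linarith [hN₀ N hN]

end CesaroMeans

/-! ### Van der Corput's lemma. -/

section VanDerCorput

variable {E F : Type*} [NormedAddCommGroup E] [InnerProductSpace ℂ E]
  [NormedAddCommGroup F] [InnerProductSpace ℂ F]

/-- Cauchy–Schwarz. The mean square is kept as a complex mean of inner products, the form in which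
correlations converge. -/
lemma norm_cesaroMean_sq_le (v : ℕ → E) (N : ℕ) :
    ‖cesaroMean v N‖ ^ 2 ≤ ‖cesaroMean (fun n => inner ℂ (v n) (v n)) N‖ := by
  rcases Nat.eq_zero_or_pos N with rfl | hN
  · simp [cesaroMean]
  have hN' : (0 : ℝ) < N := by exact_mod_cast hN
  have h1 := norm_cesaroMean_le_avg v N
  have h2 : ‖cesaroMean (fun n => inner ℂ (v n) (v n)) N‖
      = (N : ℝ)⁻¹ * ∑ n ∈ Finset.Icc 1 N, ‖v n‖ ^ 2 := by
    have : cesaroMean (fun n => inner ℂ (v n) (v n)) N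
        = (((N : ℝ)⁻¹ * ∑ n ∈ Finset.Icc 1 N, ‖v n‖ ^ 2 : ℝ) : ℂ) := by
      simp [cesaroMean, inner_self_eq_norm_sq_to_K]
    rw [this, Complex.norm_real, Real.norm_of_nonneg (by positivity)]
  have h3 := sq_sum_le_card_mul_sum_sq (s := Finset.Icc 1 N) (f := fun n => ‖v n‖)
  rw [Nat.card_Icc, Nat.add_sub_cancel] at h3
  calc ‖cesaroMean v N‖ ^ 2 ≤ ((N : ℝ)⁻¹ * ∑ n ∈ Finset.Icc 1 N, ‖v n‖) ^ 2 := by gcongr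
    _ = (N : ℝ)⁻¹ ^ 2 * (∑ n ∈ Finset.Icc 1 N, ‖v n‖) ^ 2 := by ring
    _ ≤ (N : ℝ)⁻¹ ^ 2 * (N * ∑ n ∈ Finset.Icc 1 N, ‖v n‖ ^ 2) := by gcongr
    _ = _ := by rw [h2]; field_simp

lemma inner_average_average (H : ℕ) (y : ℕ → E) :
    inner ℂ ((H : ℂ)⁻¹ • ∑ h ∈ Finset.range H, y h) ((H : ℂ)⁻¹ • ∑ h ∈ Finset.range H, y h)
      = ((H : ℂ)⁻¹ * (H : ℂ)⁻¹) • ∑ h ∈ Finset.range H, ∑ h' ∈ Finset.range H,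
        inner ℂ (y h) (y h') := by
  simp only [inner_smul_left, inner_smul_right, map_inv₀, Complex.conj_natCast,
    sum_inner, inner_sum, smul_eq_mul, ← Finset.mul_sum]
  rw [Finset.sum_comm, mul_assoc]

/-- A form of van der Corput's lemma, in which the shifts of the sequence may be perturbed by
sequences with vanishing Cesàro means. -/
theorem tendsto_cesaroMean_zero_of_correlations {u : ℕ → E} {w : ℕ → ℕ → E} {z : ℕ → F} {C : ℝ}
    (hu : ∀ n, ‖u n‖ ≤ C)
    (hw : ∀ h, Tendsto (cesaroMean fun n => u (n + h) - w n h) atTop (𝓝 0))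
    (hwz : ∀ h h', Tendsto (cesaroMean fun n => inner ℂ (w n h) (w n h')) atTop
      (𝓝 (inner ℂ (z h) (z h'))))
    (hz : Tendsto (fun H : ℕ => (H : ℂ)⁻¹ • ∑ h ∈ Finset.range H, z h) atTop (𝓝 0)) :
    Tendsto (cesaroMean u) atTop (𝓝 0) := by
  rw [Metric.tendsto_atTop]
  intro ε hε
  obtain ⟨H₀, hH₀⟩ := Metric.tendsto_atTop.1 hz (ε / 2) (by positivity)
  obtain ⟨H, hHH, hH1⟩ : ∃ H, H₀ ≤ H ∧ 1 ≤ H := ⟨H₀ + 1, by omega, by omega⟩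
  have hHne : (H : ℂ) ≠ 0 := by exact_mod_cast (by omega : H ≠ 0)
  have hg := hH₀ H hHH
  rw [dist_zero_right] at hg
  set v : ℕ → E := fun n => (H : ℂ)⁻¹ • ∑ h ∈ Finset.range H, w n h with hv
  set g : F := (H : ℂ)⁻¹ • ∑ h ∈ Finset.range H, z h with hgdef
  -- For each fixed `h`, `u n`, `u (n + h)` and `w n h` have asymptotically equal means, so
  -- averaging over `h < H` is harmless.
  have h1 : Tendsto (cesaroMean fun n => u n - v n) atTop (𝓝 0) := by
    have hterm : ∀ h, Tendsto (cesaroMean fun n => u n - w n h) atTop (𝓝 0) := by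
      intro h
      have := (hw h).sub (tendsto_cesaroMean_shift hu h)
      rw [sub_zero] at this
      refine this.congr fun N => ?_
      rw [← cesaroMean_sub]
      congr 1
      funext n
      abel
    have hs := (tendsto_finsetSum (Finset.range H) fun h _ => hterm h).const_smul (H : ℂ)⁻¹
    rw [Finset.sum_const_zero, smul_zero] at hs
    refine hs.congr fun N => ?_
    rw [← cesaroMean_sum, ← cesaroMean_smul]
    congr 1
    funext n
    rw [Finset.sum_sub_distrib, smul_sub, hv, Finset.sum_const, Finset.card_range,
      ← Nat.cast_smul_eq_nsmul ℂ, smul_smul, inv_mul_cancel₀ hHne, one_smul]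
  -- Expanding the square gives `H²` correlations, whose limits reassemble to `‖g‖²`; this is small
  -- by the choice of `H`.
  have h2 : Tendsto (cesaroMean fun n => inner ℂ (v n) (v n)) atTop (𝓝 (inner ℂ g g)) := by
    have hs := (tendsto_finsetSum (Finset.range H) fun h _ =>
      tendsto_finsetSum (Finset.range H) fun h' _ => hwz h h').const_smul ((H : ℂ)⁻¹ * (H : ℂ)⁻¹)
    rw [hgdef, inner_average_average]
    refine hs.congr fun N => ?_
    simp only [hv, inner_average_average]
    rw [cesaroMean_smul, cesaroMean_sum]
    simp only [cesaroMean_sum]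
  have h3 : ∀ᶠ N in atTop, ‖cesaroMean (fun n => inner ℂ (v n) (v n)) N‖ < (ε / 2) ^ 2 := by
    refine h2.norm.eventually_lt_const ?_
    rw [inner_self_eq_norm_sq_to_K]
    simp only [norm_pow, Complex.coe_algebraMap, Complex.norm_real, norm_norm]
    gcongr
  obtain ⟨N₁, hN₁⟩ := Metric.tendsto_atTop.1 h1 (ε / 2) (by positivity)
  obtain ⟨N₂, hN₂⟩ := eventually_atTop.1 h3
  refine ⟨max N₁ N₂, fun N hN => ?_⟩
  have a1 := hN₁ N (le_trans (le_max_left _ _) hN)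
  have a2 := (norm_cesaroMean_sq_le v N).trans_lt (hN₂ N (le_trans (le_max_right _ _) hN))
  have a3 : ‖cesaroMean v N‖ < ε / 2 := lt_of_pow_lt_pow_left₀ 2 (by positivity) a2
  rw [dist_zero_right] at a1 ⊢
  have : cesaroMean u N = cesaroMean (fun n => u n - v n) N + cesaroMean v N := by
    rw [cesaroMean_sub]; abel
  rw [this]
  exact (norm_add_le _ _).trans_lt (by linarith)

end VanDerCorput

/-! ### Averages of `Sⁿ V^(log₂ n)` for commuting isometries. -/

section Ergodicity

variable {E : Type*} [NormedAddCommGroup E] [InnerProductSpace ℂ E]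

lemma LinearIsometry.mul_apply' (S V : E →ₗᵢ[ℂ] E) (x : E) : (S * V) x = S (V x) := rfl

lemma LinearIsometry.pow_apply_eq_self {S : E →ₗᵢ[ℂ] E} {x : E} (hx : S x = x) (n : ℕ) :
    (S ^ n) x = x := by
  induction n with
  | zero => simp
  | succ k ih => rw [pow_succ, LinearIsometry.mul_apply', hx, ih]

lemma LinearIsometry.pow_apply_eq_iterate (S : E →ₗᵢ[ℂ] E) (n : ℕ) (x : E) :
    (S ^ n) x = S^[n] x := by
  induction n generalizing x with
  | zero => simp
  | succ k ih => rw [pow_succ, LinearIsometry.mul_apply', ih, Function.iterate_succ_apply]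

/-- If the averages of `S ^ n V ^ ⌊log₂ n⌋` along an `S`-invariant vector `x` converge to a
`V`-invariant vector `c`, then `x = c`. -/
lemma eq_of_tendsto_cesaroMean_log {S V : E →ₗᵢ[ℂ] E} (hcomm : Commute S V) {x c : E}
    (hx : S x = x) (hc : V c = c)
    (h : Tendsto (cesaroMean fun n => (S ^ n * V ^ Nat.log 2 n) x) atTop (𝓝 c)) : x = c := by
  -- Invariance of `x` removes `Sⁿ`, leaving a function of `log₂ n` alone. Its block values have
  -- constant norm `‖x - c‖`, yet they must tend to zero.
  have h1 : Tendsto (cesaroMean fun n => (V ^ Nat.log 2 n) (x - c)) atTop (𝓝 0) := by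
    have := h.sub (tendsto_cesaroMean_const c)
    rw [sub_self] at this
    refine this.congr fun N => ?_
    rw [← cesaroMean_sub]
    congr 1
    funext n
    rw [(hcomm.pow_pow _ _).eq, LinearIsometry.mul_apply', LinearIsometry.pow_apply_eq_self hx,
      map_sub, LinearIsometry.pow_apply_eq_self hc]
  have h2 : Tendsto (fun _ : ℕ => ‖x - c‖) atTop (𝓝 0) := by
    refine (tendsto_zero_iff_norm_tendsto_zero.1
      (tendsto_zero_of_cesaroMean_log (v := fun k => (V ^ k) (x - c)) h1)).congr fun k => ?_
    exact (V ^ k).norm_map _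
  have h3 := tendsto_nhds_unique h2 tendsto_const_nhds
  exact sub_eq_zero.1 (norm_eq_zero.1 h3.symm)

variable [CompleteSpace E]

/-- Von Neumann's mean ergodic theorem. The last clause says that `p` is the orthogonal projection
of `x` to the fixed vectors: pairing with a fixed `y` does not see `S ^ h`. -/
lemma LinearIsometry.exists_tendsto_averages (S : E →ₗᵢ[ℂ] E) (x : E) :
    ∃ p, S p = p ∧ Tendsto (fun H : ℕ => (H : ℂ)⁻¹ • ∑ h ∈ Finset.range H, (S ^ h) x) atTop (𝓝 p) ∧
      ∀ y, S y = y → inner ℂ y p = inner ℂ y x := by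
  obtain ⟨p, hp, hlim⟩ : ∃ p, S p = p ∧
      Tendsto (birkhoffAverage ℂ S.toContinuousLinearMap _root_.id · x) atTop (𝓝 p) := by
    have h := S.toContinuousLinearMap.tendsto_birkhoffAverage_orthogonalProjection
      S.norm_toContinuousLinearMap_le x
    refine ⟨_, ?_, h⟩
    exact LinearMap.mem_eqLocus.1 (Submodule.coe_mem _)
  have hlim' : Tendsto (fun H : ℕ => (H : ℂ)⁻¹ • ∑ h ∈ Finset.range H, (S ^ h) x) atTop
      (𝓝 p) := by
    refine hlim.congr fun N => ?_
    simp [birkhoffAverage, birkhoffSum, LinearIsometry.pow_apply_eq_iterate]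
  refine ⟨p, hp, hlim', fun y hy => ?_⟩
  refine tendsto_nhds_unique ((innerSL ℂ y).continuous.tendsto _ |>.comp hlim') ?_
  refine tendsto_const_nhds.congr' ?_
  filter_upwards [eventually_ne_atTop 0] with H hH
  have hH' : (H : ℂ) ≠ 0 := by exact_mod_cast hH
  have : ∀ h, inner ℂ y ((S ^ h) x) = inner ℂ y x := fun h => by
    conv_lhs => rw [← LinearIsometry.pow_apply_eq_self hy h]
    exact (S ^ h).inner_map_map _ _
  simp [inner_smul_right, inner_sum, this, hH']

/-- The mean ergodic theorem when `e` spans the invariant vectors. -/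
lemma tendsto_averages_of_invariant {S : E →ₗᵢ[ℂ] E} {e : E}
    (he : S e = e) (hinv : ∀ x, S x = x → x = inner ℂ e x • e) (x : E) :
    Tendsto (fun H : ℕ => (H : ℂ)⁻¹ • ∑ h ∈ Finset.range H, (S ^ h) x) atTop
      (𝓝 (inner ℂ e x • e)) := by
  obtain ⟨p, hp, hlim, hinner⟩ := S.exists_tendsto_averages x
  rw [← hinner e he, ← hinv p hp]
  exact hlim

/-- If `e` spans the `S`-invariant vectors, then the averages of `S ^ n V ^ ⌊log₂ n⌋` converge
to the projection to the span of `e`. -/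
lemma tendsto_cesaroMean_log_of_invariant {S V : E →ₗᵢ[ℂ] E} (hcomm : Commute S V) {e : E}
    (he : S e = e) (heV : V e = e)
    (hinv : ∀ x, S x = x → x = inner ℂ e x • e) (x : E) :
    Tendsto (cesaroMean fun n => (S ^ n * V ^ Nat.log 2 n) x) atTop (𝓝 (inner ℂ e x • e)) := by
  set W : ℕ → E →ₗᵢ[ℂ] E := fun n => S ^ n * V ^ Nat.log 2 n with hW
  -- `W n (S y)` equals `W (n + 1) y` unless `log₂` jumps from `n` to `n + 1`, so up to rare errors
  -- the averages telescope.
  have hcob : ∀ y, Tendsto (cesaroMean fun n => W n (y - S y)) atTop (𝓝 0) := by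
    intro y
    have h1 := tendsto_cesaroMean_shift (u := fun n => W n y) (C := ‖y‖) (by simp) 1
    have h2 : Tendsto (cesaroMean fun n => W (n + 1) y - W n (S y)) atTop (𝓝 0) := by
      refine tendsto_cesaroMean_zero_of_le_log_shift (C := 2 * ‖y‖) (by positivity) 1
        fun n hn => ?_
      have e1 : W n (S y) = (S ^ (n + 1)) ((V ^ Nat.log 2 n) y) := by
        rw [← LinearIsometry.mul_apply', hW]
        simp only
        rw [mul_assoc, ← (hcomm.pow_right _).eq, ← mul_assoc, ← pow_succ,
          LinearIsometry.mul_apply']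
      have e2 : W (n + 1) y = (S ^ (n + 1)) ((V ^ Nat.log 2 (n + 1)) y) := rfl
      rw [e1, e2, ← map_sub, LinearIsometry.norm_map]
      rcases (Nat.log_mono_right (b := 2) (Nat.le_succ n)).eq_or_lt with h | h
      · simp only [Nat.succ_eq_add_one] at h
        simp [h]
      · have h' : (1 : ℝ) ≤ (Nat.log 2 (n + 1) : ℝ) - Nat.log 2 n := by
          rw [le_sub_iff_add_le']
          exact_mod_cast h
        calc _ ≤ ‖(V ^ Nat.log 2 (n + 1)) y‖ + ‖(V ^ Nat.log 2 n) y‖ := norm_sub_le _ _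
          _ = 2 * ‖y‖ * 1 := by simp only [LinearIsometry.norm_map]; ring
          _ ≤ _ := by gcongr
    have h3 := h2.sub h1
    rw [sub_zero] at h3
    refine h3.congr fun N => ?_
    rw [← cesaroMean_sub]
    congr 1
    funext n
    rw [map_sub]
    abel
  have hcobs : ∀ h, Tendsto (cesaroMean fun n => W n (x - (S ^ h) x)) atTop (𝓝 0) := by
    intro h
    induction h with
    | zero => simpa using tendsto_cesaroMean_const (0 : E)
    | succ k ih =>
      have h3 := ih.add (hcob ((S ^ k) x))
      rw [add_zero] at h3
      refine h3.congr fun N => ?_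
      rw [← cesaroMean_add]
      congr 1
      funext n
      rw [← map_add, ← LinearIsometry.mul_apply', ← pow_succ']
      congr 1
      abel
  have hclosed : IsClosed {x : E | Tendsto (fun N => cesaroMean (fun n => W n x) N) atTop
      (𝓝 ((fun _ => (0 : E)) x))} := by
    refine isClosed_setOf_tendsto_clm (C := 1) (fun N x y => ?_) continuous_const
    rw [← cesaroMean_sub, one_mul]
    refine norm_cesaroMean_le (fun n => ?_) N
    rw [← map_sub, LinearIsometry.norm_map]
  -- By the mean ergodic theorem this vector is a limit of averages of `x - S ^ h x`, each a sum of
  -- coboundaries.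
  have hmem : x - inner ℂ e x • e ∈ {x : E | Tendsto (fun N => cesaroMean (fun n => W n x) N) atTop
      (𝓝 ((fun _ => (0 : E)) x))} := by
    have hlim := (tendsto_averages_of_invariant he hinv x).const_sub x
    refine hclosed.mem_of_tendsto hlim ?_
    filter_upwards [eventually_ne_atTop 0] with H hH
    have hH' : (H : ℂ) ≠ 0 := by exact_mod_cast hH
    have hs := (tendsto_finsetSum (Finset.range H) fun h _ => hcobs h).const_smul (H : ℂ)⁻¹
    rw [Finset.sum_const_zero, smul_zero] at hs
    refine hs.congr fun N => ?_
    rw [← cesaroMean_sum, ← cesaroMean_smul]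
    congr 1
    funext n
    rw [← map_sum, ← map_smul, Finset.sum_sub_distrib, smul_sub, Finset.sum_const,
      Finset.card_range, ← Nat.cast_smul_eq_nsmul ℂ, smul_smul, inv_mul_cancel₀ hH', one_smul]
  have h4 := Tendsto.add hmem (tendsto_cesaroMean_const (inner ℂ e x • e))
  rw [zero_add] at h4
  refine h4.congr fun N => ?_
  rw [← cesaroMean_add]
  congr 1
  funext n
  have : W n e = e := by
    rw [hW]
    simp only
    rw [LinearIsometry.mul_apply', LinearIsometry.pow_apply_eq_self heV, LinearIsometry.pow_apply_eq_self he]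
  rw [map_sub, map_smul, this]
  abel

end Ergodicity

/-! ### Spectral measures of unitary operators and Wiener's lemma. -/

section SpectralMeasure

variable {H : Type*} [NormedAddCommGroup H] [InnerProductSpace ℂ H] [CompleteSpace H]

/-- A real continuous function, viewed as a complex one. -/
noncomputable def ContinuousMap.complexify {K : Type*} [TopologicalSpace K] (g : C(K, ℝ)) :
    C(K, ℂ) := ⟨fun t => (g t : ℂ), by fun_prop⟩

open scoped CompactlySupported in
/-- The positive functional `g ↦ ⟪x, g(a) x⟫` attached to a normal operator `a`. -/
noncomputable def spectralFunctional (a : H →L[ℂ] H) [ha : IsStarNormal a] (x : H) :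
    C_c(spectrum ℂ a, ℝ) →ₚ[ℝ] ℝ :=
  PositiveLinearMap.mk₀
    { toFun := fun g => (inner ℂ x (cfcHom ha g.toContinuousMap.complexify x)).re
      map_add' := fun f g => by
        rw [← Complex.add_re, ← inner_add_right, ← add_apply, ← map_add]
        congr 5
        ext t
        simp [ContinuousMap.complexify]
      map_smul' := fun c f => by
        have : (c • f).toContinuousMap.complexify = (c : ℂ) • f.toContinuousMap.complexify := by
          ext t
          simp [ContinuousMap.complexify]
        rw [this, map_smul, smul_apply, inner_smul_right]
        simp }
    (fun f hf => by
      have hf' : ∀ t, 0 ≤ f t := hf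
      -- With `f = g²` the functional takes the value `‖g(a) x‖²`.
      set g : C(spectrum ℂ a, ℝ) := ⟨fun t => Real.sqrt (f t), by fun_prop⟩ with hg
      have : f.toContinuousMap.complexify = star g.complexify * g.complexify := by
        ext t
        simp only [ContinuousMap.complexify, hg, ContinuousMap.coe_mk, ContinuousMap.mul_apply,
          ContinuousMap.star_apply, Complex.star_def, Complex.conj_ofReal]
        rw [← Complex.ofReal_mul, Real.mul_self_sqrt (hf' t)]
        rfl
      change 0 ≤ (inner ℂ x (cfcHom ha f.toContinuousMap.complexify x)).re
      rw [this, map_mul, map_star, mul_apply_eq_comp, ContinuousLinearMap.star_eq_adjoint,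
        ContinuousLinearMap.adjoint_inner_right]
      exact inner_self_nonneg (𝕜 := ℂ))

lemma im_inner_cfcHom_complexify (a : H →L[ℂ] H) [ha : IsStarNormal a] (x : H)
    (g : C(spectrum ℂ a, ℝ)) : (inner ℂ x (cfcHom ha g.complexify x)).im = 0 := by
  have hstar : star g.complexify = g.complexify := by
    ext t
    simp [ContinuousMap.complexify]
  have h : ContinuousLinearMap.adjoint (cfcHom ha g.complexify) = cfcHom ha g.complexify := by
    rw [← ContinuousLinearMap.star_eq_adjoint, ← map_star, hstar]
  rw [← Complex.conj_eq_iff_im, inner_conj_symm]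
  conv_lhs => rw [← h]
  rw [ContinuousLinearMap.adjoint_inner_left]

/-- The Riesz measure represents the functional on real functions; complex ones are split into real
and imaginary parts. -/
lemma integral_spectralFunctional (a : H →L[ℂ] H) [ha : IsStarNormal a] (x : H)
    (f : C(spectrum ℂ a, ℂ)) :
    ∫ t, f t ∂(RealRMK.rieszMeasure (spectralFunctional a x)) = inner ℂ x (cfcHom ha f x) := by
  set ν := RealRMK.rieszMeasure (spectralFunctional a x) with hν
  have hreal : ∀ g : C(spectrum ℂ a, ℝ),
      ((∫ t, g t ∂ν : ℝ) : ℂ) = inner ℂ x (cfcHom ha g.complexify x) := by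
    intro g
    have h := RealRMK.integral_rieszMeasure (spectralFunctional a x)
      (CompactlySupportedContinuousMap.continuousMapEquiv g)
    apply Complex.ext
    · rw [Complex.ofReal_re]
      exact h
    · rw [im_inner_cfcHom_complexify, Complex.ofReal_im]
  set fr : C(spectrum ℂ a, ℝ) := ⟨fun t => (f t).re, by fun_prop⟩ with hfr
  set fi : C(spectrum ℂ a, ℝ) := ⟨fun t => (f t).im, by fun_prop⟩ with hfi
  have hf : f = fr.complexify + Complex.I • fi.complexify := by
    ext t
    simp [ContinuousMap.complexify, hfr, hfi, mul_comm Complex.I, Complex.re_add_im]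
  have hint : ∀ g : C(spectrum ℂ a, ℂ), Integrable g ν := fun g =>
    (g.continuous).integrable_of_hasCompactSupport (HasCompactSupport.of_compactSpace g)
  have h1 : ∫ t, f t ∂ν = ∫ t, fr.complexify t ∂ν + Complex.I * ∫ t, fi.complexify t ∂ν := by
    rw [← integral_const_mul, ← integral_add (hint _) ((hint _).const_mul _)]
    refine integral_congr_ae (Eventually.of_forall fun t => ?_)
    conv_lhs => rw [hf]
    rfl
  have h2 : ∀ g : C(spectrum ℂ a, ℝ), ∫ t, g.complexify t ∂ν = ((∫ t, g t ∂ν : ℝ) : ℂ) :=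
    fun g => integral_ofReal
  rw [h1, h2, h2, hreal, hreal]
  conv_rhs => rw [hf]
  rw [map_add, map_smul, add_apply, smul_apply, inner_add_right, inner_smul_right]

/-- The spectral measure of a unitary operator at a vector. -/
theorem exists_spectralMeasure (U : H ≃ₗᵢ[ℂ] H) (x : H) :
    ∃ σ : Measure ℂ, IsFiniteMeasure σ ∧ (∀ᵐ z ∂σ, ‖z‖ = 1) ∧
      ∀ n : ℕ, ∫ z, z ^ n ∂σ = inner ℂ x ((U.toLinearIsometry ^ n) x) := by
  set u := Unitary.linearIsometryEquiv.symm U with hu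
  set a : H →L[ℂ] H := (u : H →L[ℂ] H) with ha
  have hau : a ∈ unitary (H →L[ℂ] H) := u.2
  have hax : ∀ y, a y = U y := fun y => rfl
  have hn : IsStarNormal a := ⟨by
    rw [commute_iff_eq, Unitary.star_mul_self_of_mem hau, Unitary.mul_star_self_of_mem hau]⟩
  set ν := RealRMK.rieszMeasure (spectralFunctional a x) with hν
  have hmeas : Measurable (Subtype.val : spectrum ℂ a → ℂ) := measurable_subtype_coe
  -- Pushing forward to `ℂ` lets the measures of two different operators be compared. The spectrum
  -- of a unitary lies on the unit circle.
  refine ⟨ν.map Subtype.val, inferInstance, ?_, fun n => ?_⟩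
  · rw [ae_map_iff hmeas.aemeasurable (measurableSet_eq_fun measurable_norm measurable_const)]
    exact Eventually.of_forall fun t => spectrum.norm_eq_one_of_unitary hau t.2
  · rw [integral_map hmeas.aemeasurable (by fun_prop)]
    set idn : C(spectrum ℂ a, ℂ) := (ContinuousMap.id ℂ).restrict (spectrum ℂ a) with hid
    have h := integral_spectralFunctional a x (idn ^ n)
    rw [map_pow, cfcHom_id] at h
    have hpow : ∀ m : ℕ, (a ^ m) x = (U.toLinearIsometry ^ m) x := by
      intro m
      induction m with
      | zero => rfl
      | succ k ih =>
        rw [pow_succ', pow_succ', mul_apply_eq_comp, ih]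
        rfl
    rw [hpow] at h
    exact h

/-- The averages of `f ^ h` are bounded by `1` and, by the geometric sum, converge pointwise to the
indicator of `f = 1`. -/
lemma tendsto_integral_average_pow {Y : Type*} [MeasurableSpace Y] (ν : Measure Y)
    [IsFiniteMeasure ν] {f : Y → ℂ} (hf : Measurable f) (hf1 : ∀ᵐ t ∂ν, ‖f t‖ = 1) :
    Tendsto (fun N : ℕ => (N : ℂ)⁻¹ * ∑ h ∈ Finset.range N, ∫ t, f t ^ h ∂ν) atTop
      (𝓝 (ν.real {t | f t = 1} : ℂ)) := by
  have hset : MeasurableSet {t | f t = 1} := hf (measurableSet_singleton 1)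
  have hlim : Tendsto (fun N : ℕ => ∫ t, (N : ℂ)⁻¹ * ∑ h ∈ Finset.range N, f t ^ h ∂ν) atTop
      (𝓝 (∫ t, Set.indicator {t | f t = 1} (fun _ => (1 : ℂ)) t ∂ν)) := by
    refine tendsto_integral_of_dominated_convergence (fun _ => (1 : ℝ))
      (fun N => by fun_prop) (integrable_const _) (fun N => ?_) ?_
    · filter_upwards [hf1] with t ht
      rw [norm_mul, norm_inv, Complex.norm_natCast]
      have : ‖∑ h ∈ Finset.range N, f t ^ h‖ ≤ N := by
        refine (norm_sum_le _ _).trans ?_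
        simp [ht]
      exact inv_mul_le_one_of_le₀ this (by positivity)
    · filter_upwards [hf1] with t ht
      by_cases h1 : f t = 1
      · have : Set.indicator {t | f t = 1} (fun _ => (1 : ℂ)) t = 1 := by
          simp [h1]
        rw [this]
        refine tendsto_const_nhds.congr' ?_
        filter_upwards [eventually_ne_atTop 0] with N hN
        have hN' : (N : ℂ) ≠ 0 := by exact_mod_cast hN
        simp [h1, hN']
      · have : Set.indicator {t | f t = 1} (fun _ => (1 : ℂ)) t = 0 := by
          simp [h1]
        rw [this]
        have h2 : Tendsto (fun N : ℕ => (N : ℝ)⁻¹ * (2 / ‖f t - 1‖)) atTop (𝓝 0) := by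
          simpa using (tendsto_inv_atTop_nhds_zero_nat (𝕜 := ℝ)).mul_const (2 / ‖f t - 1‖)
        refine squeeze_zero_norm (fun N => ?_) h2
        rw [norm_mul, norm_inv, Complex.norm_natCast, geom_sum_eq h1, norm_div]
        gcongr
        refine (norm_sub_le _ _).trans ?_
        simp only [norm_pow, ht, one_pow, norm_one]
        norm_num
  rw [integral_indicator_const _ hset] at hlim
  simp only [Complex.real_smul, mul_one] at hlim
  refine hlim.congr fun N => ?_
  rw [integral_const_mul, integral_finsetSum]
  intro h _
  refine (integrable_const (1 : ℝ)).mono' (by fun_prop) ?_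
  filter_upwards [hf1] with t ht
  simp [ht]

/-- An atom of a spectral measure is an eigenvalue. -/
lemma exists_eigenvector_of_atom (U : H ≃ₗᵢ[ℂ] H) (x : H) {σ : Measure ℂ} [IsFiniteMeasure σ]
    (hσ : ∀ᵐ z ∂σ, ‖z‖ = 1)
    (hσx : ∀ n : ℕ, ∫ z, z ^ n ∂σ = inner ℂ x ((U.toLinearIsometry ^ n) x))
    {c : ℂ} (hc : σ {c} ≠ 0) :
    ‖c‖ = 1 ∧ ∃ e, U e = c • e ∧ inner ℂ x e ≠ 0 := by
  have hc1 : ‖c‖ = 1 := by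
    by_contra h
    exact hc (measure_mono_null (by simpa using h) hσ)
  have hc0 : c ≠ 0 := by
    rintro rfl
    simp at hc1
  refine ⟨hc1, ?_⟩
  -- The fixed vectors of `V = c⁻¹ U` are the `c`-eigenvectors of `U`. The projection `p` of `x` to
  -- them satisfies `⟪x, p⟫ = σ {c}`.
  set V : H →ₗᵢ[ℂ] H :=
    { toLinearMap := c⁻¹ • (U.toLinearIsometry.toLinearMap)
      norm_map' := fun y => by simp [norm_smul, hc1] } with hV
  have hVy : ∀ y, V y = c⁻¹ • U y := fun y => rfl
  have hVn : ∀ n : ℕ, (V ^ n) x = c⁻¹ ^ n • (U.toLinearIsometry ^ n) x := by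
    intro n
    induction n with
    | zero => simp
    | succ k ih =>
      rw [pow_succ', LinearIsometry.mul_apply', ih, map_smul, hVy, smul_smul, ← pow_succ,
        pow_succ' U.toLinearIsometry, LinearIsometry.mul_apply']
      rfl
  obtain ⟨p, hp, hlim, -⟩ := V.exists_tendsto_averages x
  refine ⟨p, ?_, ?_⟩
  · conv_rhs => rw [← hp]
    rw [hVy, smul_smul, mul_inv_cancel₀ hc0, one_smul]
  have h1 := ((innerSL ℂ x).continuous.tendsto _).comp hlim
  have h2 := tendsto_integral_average_pow σ (f := fun z => c⁻¹ * z) (by fun_prop)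
    (by filter_upwards [hσ] with z hz; simp [hz, hc1])
  have hset : {z : ℂ | c⁻¹ * z = 1} = {c} := by
    ext z
    simp only [Set.mem_ofPred_eq, Set.mem_singleton_iff]
    rw [inv_mul_eq_one₀ hc0, eq_comm]
  rw [hset] at h2
  have h3 : inner ℂ x p = (σ.real {c} : ℂ) := by
    refine tendsto_nhds_unique h1 (h2.congr fun N => ?_)
    simp only [Function.comp_apply, innerSL_apply_apply, inner_smul_right, inner_sum, hVn, mul_pow,
      integral_const_mul, hσx]
  rw [h3]
  exact_mod_cast (measureReal_ne_zero_iff).2 hc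

/-- **Wiener's lemma** for a pair of unitary operators: if the correlations of two vectors do not
decay on average, then the operators have eigenvalues that are inverse to each other. -/
theorem exists_eigenvectors_of_correlations {K : Type*} [NormedAddCommGroup K]
    [InnerProductSpace ℂ K] [CompleteSpace K] (U : H ≃ₗᵢ[ℂ] H) (V : K ≃ₗᵢ[ℂ] K) (x : H) (y : K)
    {p : ℂ} (hlim : Tendsto (fun N : ℕ => (N : ℂ)⁻¹ * ∑ h ∈ Finset.range N,
      inner ℂ x ((U.toLinearIsometry ^ h) x) * inner ℂ y ((V.toLinearIsometry ^ h) y)) atTop (𝓝 p))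
    (hp : p ≠ 0) :
    ∃ c : ℂ, ‖c‖ = 1 ∧ ∃ e f, U e = c⁻¹ • e ∧ V f = c • f ∧
      inner ℂ x e ≠ 0 ∧ inner ℂ y f ≠ 0 := by
  obtain ⟨σ, hσf, hσ1, hσ⟩ := exists_spectralMeasure U x
  obtain ⟨τ, hτf, hτ1, hτ⟩ := exists_spectralMeasure V y
  have hm1 : MeasurableSet {z : ℂ | ‖z‖ = 1} := measurableSet_eq_fun measurable_norm measurable_const
  have hprod1 : ∀ᵐ t ∂(σ.prod τ), ‖t.1 * t.2‖ = 1 := by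
    have h1 : ∀ᵐ t ∂(σ.prod τ), ‖t.1‖ = 1 := Measure.quasiMeasurePreserving_fst.ae hσ1
    have h2 : ∀ᵐ t ∂(σ.prod τ), ‖t.2‖ = 1 := Measure.quasiMeasurePreserving_snd.ae hτ1
    filter_upwards [h1, h2] with t ht1 ht2
    rw [norm_mul, ht1, ht2, one_mul]
  -- Products of moments are moments of `z * w` under `σ × τ`, so `p` is the mass of `{z * w = 1}`.
  have h1 := tendsto_integral_average_pow (σ.prod τ) (f := fun t => t.1 * t.2) (by fun_prop) hprod1
  have h2 : p = ((σ.prod τ).real {t | t.1 * t.2 = 1} : ℂ) := by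
    refine tendsto_nhds_unique hlim (h1.congr fun N => ?_)
    congr 1
    refine Finset.sum_congr rfl fun h _ => ?_
    simp only [mul_pow]
    rw [integral_prod_mul (fun z : ℂ => z ^ h) (fun z : ℂ => z ^ h), hσ, hτ]
  have h3 : (σ.prod τ) {t | t.1 * t.2 = 1} ≠ 0 := by
    intro h
    apply hp
    rw [h2, measureReal_def, h]
    simp
  have hset : MeasurableSet {t : ℂ × ℂ | t.1 * t.2 = 1} :=
    measurableSet_eq_fun (by fun_prop) measurable_const
  set D : Set ℂ := {w | 0 < τ {w}} with hD
  have hDc : D.Countable :=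
    Measure.countable_meas_pos_of_disjoint_iUnion (fun w => measurableSet_singleton w)
      (fun a b hab => by simpa using hab)
  -- By Fubini the mass is the `σ`-integral of `τ {z⁻¹}`, which is nonzero only at the inverses of
  -- the countably many atoms of `τ`; so `σ` must charge one of these.
  obtain ⟨z, hzσ, hzτ⟩ : ∃ z, σ {z} ≠ 0 ∧ τ {z⁻¹} ≠ 0 := by
    by_contra! hcon
    apply h3
    rw [Measure.measure_prod_null hset]
    have hnull : σ ((fun z => z⁻¹) ⁻¹' D) = 0 := by
      have hcnt : ((fun z : ℂ => z⁻¹) ⁻¹' D).Countable := hDc.preimage inv_injective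
      rw [← Set.biUnion_of_singleton ((fun z : ℂ => z⁻¹) ⁻¹' D), measure_biUnion_null_iff hcnt]
      intro z hz
      by_contra hne
      exact (ne_of_gt hz) (hcon z hne)
    have hae : ∀ᵐ z ∂σ, z ∉ (fun z : ℂ => z⁻¹) ⁻¹' D := measure_eq_zero_iff_ae_notMem.1 hnull
    filter_upwards [hae, hσ1] with z hz hz1
    have hz0 : z ≠ 0 := by
      rintro rfl
      simp at hz1
    have : Prod.mk z ⁻¹' {t : ℂ × ℂ | t.1 * t.2 = 1} = {z⁻¹} := by
      ext w
      simp only [Set.mem_preimage, Set.mem_ofPred_eq, Set.mem_singleton_iff]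
      constructor
      · intro h
        exact eq_inv_of_mul_eq_one_right h
      · rintro rfl
        exact mul_inv_cancel₀ hz0
    rw [this]
    simpa [hD] using hz
  obtain ⟨-, e, he, hxe⟩ := exists_eigenvector_of_atom U x hσ1 hσ hzσ
  obtain ⟨hz1, f, hf, hyf⟩ := exists_eigenvector_of_atom V y hτ1 hτ hzτ
  exact ⟨z⁻¹, hz1, e, f, by rw [inv_inv]; exact he, hf, hxe, hyf⟩

end SpectralMeasure

/-! ### Koopman operators and ergodicity in `L²`. -/

section Koopman

variable {Y : Type*} [MeasurableSpace Y] {ν : Measure Y}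

/-- The Koopman operator `f ↦ f ∘ R` on `L²(ν)`. -/
noncomputable def koopman {R : Y → Y} (hR : MeasurePreserving R ν ν) : Lp ℂ 2 ν →ₗᵢ[ℂ] Lp ℂ 2 ν :=
  Lp.compMeasurePreservingₗᵢ ℂ R hR

lemma koopman_toLp {R : Y → Y} (hR : MeasurePreserving R ν ν) {f : Y → ℂ} (hf : MemLp f 2 ν) :
    koopman hR (hf.toLp f) = (hf.comp_measurePreserving hR).toLp (f ∘ R) := rfl

lemma koopman_coeFn {R : Y → Y} (hR : MeasurePreserving R ν ν) (f : Lp ℂ 2 ν) :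
    koopman hR f =ᵐ[ν] f ∘ R :=
  Lp.coeFn_compMeasurePreserving f hR

lemma koopman_congr {R R' : Y → Y} (hR : MeasurePreserving R ν ν) (hR' : MeasurePreserving R' ν ν)
    (h : R = R') : koopman hR = koopman hR' := by
  subst h; rfl

lemma koopman_comp {R R' : Y → Y} (hR : MeasurePreserving R ν ν)
    (hR' : MeasurePreserving R' ν ν) : koopman (hR.comp hR') = koopman hR' * koopman hR := by
  ext1 f
  exact Lp.compMeasurePreserving_comp_apply f hR hR'

lemma koopman_id : koopman (MeasurePreserving.id ν) = 1 := by
  ext1 f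
  exact Lp.compMeasurePreserving_id_apply f

lemma koopman_iterate {R : Y → Y} (hR : MeasurePreserving R ν ν) (n : ℕ) :
    koopman (hR.iterate n) = koopman hR ^ n := by
  induction n with
  | zero => exact koopman_id
  | succ k ih =>
    rw [pow_succ', ← ih]
    exact koopman_comp (hR.iterate k) hR

lemma koopman_commute {R R' : Y → Y} (hR : MeasurePreserving R ν ν)
    (hR' : MeasurePreserving R' ν ν) (h : R ∘ R' = R' ∘ R) :
    Commute (koopman hR) (koopman hR') := by
  rw [commute_iff_eq, ← koopman_comp, ← koopman_comp]
  exact koopman_congr _ _ h.symm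

/-- The Koopman operator of an invertible transformation. -/
noncomputable def koopmanEquiv (T : Y ≃ᵐ Y) (hT : MeasurePreserving T ν ν) :
    Lp ℂ 2 ν ≃ₗᵢ[ℂ] Lp ℂ 2 ν :=
  LinearIsometryEquiv.ofSurjective (koopman hT) fun f => by
    have hT' : MeasurePreserving T.symm ν ν := hT.symm T
    refine ⟨koopman hT' f, ?_⟩
    have h : koopman (hT'.comp hT) f = f := by
      rw [koopman_congr (hT'.comp hT) (MeasurePreserving.id ν) (by ext; simp), koopman_id]
      rfl
    rw [koopman_comp] at h
    exact h

lemma koopmanEquiv_toLinearIsometry (T : Y ≃ᵐ Y) (hT : MeasurePreserving T ν ν) :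
    (koopmanEquiv T hT).toLinearIsometry = koopman hT := rfl

variable [IsProbabilityMeasure ν]

/-- The element of `L²` given by a bounded function. -/
noncomputable def MeasureTheory.MemLp.toL2 {f : Y → ℂ} (hf : MemLp f ⊤ ν) : Lp ℂ 2 ν :=
  (hf.mono_exponent le_top : MemLp f 2 ν).toLp f

lemma MeasureTheory.MemLp.coeFn_toL2 {f : Y → ℂ} (hf : MemLp f ⊤ ν) : hf.toL2 =ᵐ[ν] f :=
  MemLp.coeFn_toLp _

lemma MeasureTheory.MemLp.toL2_congr {f g : Y → ℂ} (hf : MemLp f ⊤ ν) (hg : MemLp g ⊤ ν)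
    (h : f =ᵐ[ν] g) : hf.toL2 = hg.toL2 :=
  MemLp.toLp_congr _ _ h

lemma koopman_toL2 {R : Y → Y} (hR : MeasurePreserving R ν ν) {f : Y → ℂ} (hf : MemLp f ⊤ ν) :
    koopman hR hf.toL2 = (hf.comp_measurePreserving hR).toL2 := rfl

/-- The constant function one, in `L²`. -/
noncomputable def oneL2 (ν : Measure Y) [IsProbabilityMeasure ν] : Lp ℂ 2 ν :=
  (memLp_const (1 : ℂ) : MemLp (fun _ : Y => (1 : ℂ)) ⊤ ν).toL2

lemma inner_toL2 {f g : Y → ℂ} (hf : MemLp f ⊤ ν) (hg : MemLp g ⊤ ν) :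
    inner ℂ hf.toL2 hg.toL2 = ∫ x, star (f x) * g x ∂ν := by
  rw [L2.inner_def]
  refine integral_congr_ae ?_
  filter_upwards [hf.coeFn_toL2, hg.coeFn_toL2] with x hx hy
  rw [hx, hy, RCLike.inner_apply, mul_comm]
  rfl

lemma inner_oneL2 (f : Lp ℂ 2 ν) : inner ℂ (oneL2 ν) f = ∫ x, f x ∂ν := by
  rw [L2.inner_def]
  refine integral_congr_ae ?_
  filter_upwards [(memLp_const (1 : ℂ) : MemLp (fun _ : Y => (1 : ℂ)) ⊤ ν).coeFn_toL2] with x hx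
  rw [oneL2, hx, RCLike.inner_apply]
  simp

lemma inner_oneL2_toL2 {f : Y → ℂ} (hf : MemLp f ⊤ ν) :
    inner ℂ (oneL2 ν) hf.toL2 = ∫ x, f x ∂ν := by
  rw [inner_oneL2]
  exact integral_congr_ae hf.coeFn_toL2

lemma inner_oneL2_self : inner ℂ (oneL2 ν) (oneL2 ν) = 1 := by
  rw [oneL2, inner_toL2]
  simp

lemma koopman_oneL2 {R : Y → Y} (hR : MeasurePreserving R ν ν) :
    koopman hR (oneL2 ν) = oneL2 ν := rfl

lemma smul_oneL2_coeFn (c : ℂ) : (c • oneL2 ν : Lp ℂ 2 ν) =ᵐ[ν] fun _ => c := by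
  filter_upwards [Lp.coeFn_smul c (oneL2 ν),
    (memLp_const (1 : ℂ) : MemLp (fun _ : Y => (1 : ℂ)) ⊤ ν).coeFn_toL2] with x hx hy
  rw [hx, Pi.smul_apply, oneL2, hy]
  simp

lemma norm_toL2_le {f : Y → ℂ} (hf : MemLp f ⊤ ν) {C : ℝ} (hC : 0 ≤ C)
    (h : ∀ᵐ x ∂ν, ‖f x‖ ≤ C) : ‖hf.toL2‖ ≤ C := by
  have := Lp.norm_le_of_ae_bound (f := hf.toL2) hC (by
    filter_upwards [h, hf.coeFn_toL2] with x hx hy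
    rwa [hy])
  simpa [measureUnivNNReal] using this

omit [IsProbabilityMeasure ν] in
lemma exists_ae_bound {f : Y → ℂ} (hf : MemLp f ⊤ ν) : ∃ C, 0 ≤ C ∧ ∀ᵐ x ∂ν, ‖f x‖ ≤ C := by
  refine ⟨(eLpNormEssSup f ν).toReal, ENNReal.toReal_nonneg, ?_⟩
  have hlt : eLpNormEssSup f ν ≠ ⊤ := by
    have := hf.2.ne
    rwa [eLpNorm_exponent_top] at this
  filter_upwards [enorm_ae_le_eLpNormEssSup f ν] with x hx
  rw [← toReal_enorm]
  exact ENNReal.toReal_mono hlt hx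

lemma dense_bounded : Dense {x : Lp ℂ 2 ν | ∃ (f : Y → ℂ) (hf : MemLp f ⊤ ν), hf.toL2 = x} := by
  refine (Lp.simpleFunc.denseRange (E := ℂ) (μ := ν) (p := 2) (by norm_num)).mono ?_
  rintro _ ⟨s, rfl⟩
  refine ⟨Lp.simpleFunc.toSimpleFunc s, SimpleFunc.memLp_top _ _, ?_⟩
  exact Lp.ext ((MemLp.coeFn_toL2 _).trans (Lp.simpleFunc.toSimpleFunc_eq_toFun s))

lemma cesaroMean_toL2_coeFn {u : ℕ → Y → ℂ} (hu : ∀ n, MemLp (u n) ⊤ ν) (N : ℕ) :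
    (cesaroMean (fun n => (hu n).toL2) N : Lp ℂ 2 ν) =ᵐ[ν] cesaroAvg u N := by
  have hsum : ∀ s : Finset ℕ, (∑ n ∈ s, (hu n).toL2 : Lp ℂ 2 ν) =ᵐ[ν] fun x => ∑ n ∈ s, u n x := by
    intro s
    induction s using Finset.induction_on with
    | empty =>
      simp only [Finset.sum_empty]
      exact Lp.coeFn_zero ℂ 2 ν
    | insert a s ha ih =>
      rw [Finset.sum_insert ha]
      filter_upwards [Lp.coeFn_add (hu a).toL2 (∑ n ∈ s, (hu n).toL2), (hu a).coeFn_toL2, ih]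
        with x h1 h2 h3
      rw [h1, Pi.add_apply, h2, h3, Finset.sum_insert ha]
  filter_upwards [Lp.coeFn_smul ((N : ℂ)⁻¹) (∑ n ∈ Finset.Icc 1 N, (hu n).toL2), hsum _]
    with x h1 h2
  rw [cesaroMean, h1, Pi.smul_apply, h2, cesaroAvg, one_div, smul_eq_mul]

lemma strongLimit_iff {u : ℕ → Y → ℂ} (hu : ∀ n, MemLp (u n) ⊤ ν) (c : ℂ) :
    StrongLimit ν (cesaroAvg u) c ↔
      Tendsto (cesaroMean fun n => (hu n).toL2) atTop (𝓝 (c • oneL2 ν)) := by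
  rw [tendsto_iff_edist_tendsto_0, StrongLimit]
  have : ∀ N, eLpNorm (fun x => cesaroAvg u N x - c) 2 ν
      = edist (cesaroMean (fun n => (hu n).toL2) N) (c • oneL2 ν) := by
    intro N
    rw [edist_eq_enorm_sub, Lp.enorm_def]
    refine eLpNorm_congr_ae ?_
    filter_upwards [Lp.coeFn_sub (cesaroMean (fun n => (hu n).toL2) N) (c • oneL2 ν),
      cesaroMean_toL2_coeFn hu N, smul_oneL2_coeFn (ν := ν) c] with x h1 h2 h3
    rw [h1, Pi.sub_apply, h2, h3]
  simp only [this]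

/-- Bounded functions are dense and the averages are contractions. The extension to all of `L²`
matters because invariant vectors need not be bounded a priori. -/
lemma stronglyErgodicSeq_iff {R : ℕ → Y → Y} (hR : ∀ n, MeasurePreserving (R n) ν ν) :
    StronglyErgodicSeq ν R ↔ ∀ x, Tendsto (cesaroMean fun n => koopman (hR n) x) atTop
      (𝓝 (inner ℂ (oneL2 ν) x • oneL2 ν)) := by
  have key : ∀ (f : Y → ℂ) (hf : MemLp f ⊤ ν),
      StrongLimit ν (cesaroAvg fun n x => f (R n x)) (∫ x, f x ∂ν) ↔
      Tendsto (cesaroMean fun n => koopman (hR n) hf.toL2) atTop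
        (𝓝 (inner ℂ (oneL2 ν) hf.toL2 • oneL2 ν)) := by
    intro f hf
    rw [inner_oneL2_toL2]
    exact strongLimit_iff (fun n => hf.comp_measurePreserving (hR n)) _
  constructor
  · intro h
    have hclosed : IsClosed {x : Lp ℂ 2 ν | Tendsto (fun N => cesaroMean
        (fun n => koopman (hR n) x) N) atTop (𝓝 (inner ℂ (oneL2 ν) x • oneL2 ν))} := by
      refine isClosed_setOf_tendsto_clm (C := 1) (fun N x y => ?_) (by fun_prop)
      rw [← cesaroMean_sub, one_mul]
      refine norm_cesaroMean_le (fun n => ?_) N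
      rw [← map_sub, LinearIsometry.norm_map]
    intro x
    refine closure_minimal ?_ hclosed (dense_bounded x)
    rintro _ ⟨f, hf, rfl⟩
    exact (key f hf).1 (h f hf)
  · intro h f hf
    exact (key f hf).2 (h _)

lemma weaklyErgodicSeq_tendsto {R : ℕ → Y → Y} (hR : ∀ n, MeasurePreserving (R n) ν ν)
    (h : WeaklyErgodicSeq ν R) {f g : Y → ℂ} (hf : MemLp f ⊤ ν) (hg : MemLp g ⊤ ν) :
    Tendsto (cesaroMean fun n => ∫ x, g x * f (R n x) ∂ν) atTop
      (𝓝 ((∫ x, g x ∂ν) * ∫ x, f x ∂ν)) := by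
  have h1 := h f hf g (hg.mono_exponent le_top)
  rw [integral_mul_const] at h1
  refine h1.congr fun N => ?_
  have hint : ∀ n, Integrable (fun x => g x * f (R n x)) ν := fun n =>
    (((hf.comp_measurePreserving (hR n)).mul (r := ⊤) hg).integrable le_top :)
  simp only [cesaroAvg, cesaroMean, smul_eq_mul]
  rw [← integral_finsetSum _ fun n _ => hint n, ← integral_const_mul]
  refine integral_congr_ae (Eventually.of_forall fun x => ?_)
  simp only [one_div, Finset.mul_sum]
  exact Finset.sum_congr rfl fun n _ => by ring

/-- For fixed `f` the averages are functionals of the test function, uniformly Lipschitz in `L²`, so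
bounded test functions suffice. Conjugating `f` compensates for the conjugate-linear slot of the
inner product. -/
lemma weaklyErgodicSeq_of_tendsto {R : ℕ → Y → Y} (hR : ∀ n, MeasurePreserving (R n) ν ν)
    (h : ∀ f g : Y → ℂ, MemLp f ⊤ ν → MemLp g ⊤ ν →
      Tendsto (cesaroMean fun n => ∫ x, g x * f (R n x) ∂ν) atTop
        (𝓝 ((∫ x, g x ∂ν) * ∫ x, f x ∂ν))) : WeaklyErgodicSeq ν R := by
  intro f hf g hg
  have hinner : ∀ (x : Lp ℂ 2 ν) (k : Y → ℂ) (hk : MemLp k ⊤ ν),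
      inner ℂ hk.star.toL2 x = ∫ y, x y * k y ∂ν := by
    intro x k hk
    rw [L2.inner_def]
    refine integral_congr_ae ?_
    filter_upwards [hk.star.coeFn_toL2] with y hy
    rw [hy, RCLike.inner_apply, Pi.star_apply]
    simp
  set L : ℕ → Lp ℂ 2 ν → ℂ := fun N x =>
    cesaroMean (fun n => inner ℂ (koopman (hR n) hf.star.toL2) x) N with hL
  have hclosed : IsClosed {x : Lp ℂ 2 ν | Tendsto (fun N => L N x) atTop
      (𝓝 (inner ℂ (oneL2 ν) x * ∫ y, f y ∂ν))} := by
    refine isClosed_setOf_tendsto_clm (C := ‖hf.star.toL2‖) (fun N x y => ?_) (by fun_prop)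
    rw [hL, ← cesaroMean_sub]
    refine norm_cesaroMean_le (fun n => ?_) N
    rw [← inner_sub_right]
    refine (norm_inner_le_norm _ _).trans (le_of_eq ?_)
    rw [LinearIsometry.norm_map]
  have hall : ∀ x, Tendsto (fun N => L N x) atTop (𝓝 (inner ℂ (oneL2 ν) x * ∫ y, f y ∂ν)) := by
    intro x
    refine closure_minimal ?_ hclosed (dense_bounded x)
    rintro _ ⟨k, hk, rfl⟩
    have h1 := h f k hf hk
    rw [Set.mem_ofPred_eq, inner_oneL2_toL2]
    refine h1.congr fun N => ?_
    simp only [hL]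
    congr 1
    funext n
    have h2 := hinner hk.toL2 _ (hf.comp_measurePreserving (hR n))
    refine Eq.trans ?_ h2.symm
    refine integral_congr_ae ?_
    filter_upwards [hk.coeFn_toL2] with y hy
    rw [hy]
    rfl
  have h1 := hall (hg.toLp g)
  rw [inner_oneL2, integral_congr_ae hg.coeFn_toLp, ← integral_mul_const] at h1
  refine h1.congr fun N => ?_
  have hint : ∀ n, Integrable (fun x => g x * f (R n x)) ν := fun n =>
    ((((hf.comp_measurePreserving (hR n)).mul' (r := 2) hg).integrable (by norm_num)) :)
  simp only [hL, cesaroMean, smul_eq_mul, cesaroAvg]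
  have hrhs : ∫ x, g x * (1 / (N : ℂ) * ∑ n ∈ Finset.Icc 1 N, f (R n x)) ∂ν
      = (N : ℂ)⁻¹ * ∑ n ∈ Finset.Icc 1 N, ∫ x, g x * f (R n x) ∂ν := by
    rw [← integral_finsetSum _ fun n _ => hint n, ← integral_const_mul]
    refine integral_congr_ae (Eventually.of_forall fun x => ?_)
    simp only [one_div, Finset.mul_sum]
    exact Finset.sum_congr rfl fun n _ => by ring
  rw [hrhs]
  congr 1
  refine Finset.sum_congr rfl fun n _ => ?_
  refine (hinner (hg.toLp g) _ (hf.comp_measurePreserving (hR n))).trans ?_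
  refine integral_congr_ae ?_
  filter_upwards [hg.coeFn_toLp] with y hy
  rw [hy]
  rfl

end Koopman

/-! ### Products of functions and the product space. -/

section Products

variable {X Y : Type*} [MeasurableSpace X] [MeasurableSpace Y] {μ : Measure X} {ν : Measure Y}

lemma memLp_prodComp {R₁ R₂ : Y → X} (h₁ : MeasurePreserving R₁ ν μ)
    (h₂ : MeasurePreserving R₂ ν μ) {f₁ f₂ : X → ℂ} (hf₁ : MemLp f₁ ⊤ μ) (hf₂ : MemLp f₂ ⊤ μ) :
    MemLp (fun y => f₁ (R₁ y) * f₂ (R₂ y)) ⊤ ν :=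
  (hf₂.comp_measurePreserving h₂).mul (hf₁.comp_measurePreserving h₁)

variable [IsProbabilityMeasure μ] [IsProbabilityMeasure ν]

lemma MeasureTheory.MemLp.sub_const {f : X → ℂ} (hf : MemLp f ⊤ μ) (c : ℂ) :
    MemLp (fun x => f x - c) ⊤ μ :=
  hf.sub (memLp_const c)

/-- `f₁ f₂ = (f₁ - c₁) f₂ + c₁ (f₂ - c₂) + c₁ c₂`. With `cᵢ` the integrals, this reduces convergence
to pairs in which one function has mean zero. -/
lemma prodComp_toL2_decomposition {R₁ R₂ : Y → X} (h₁ : MeasurePreserving R₁ ν μ)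
    (h₂ : MeasurePreserving R₂ ν μ) {f₁ f₂ : X → ℂ} (hf₁ : MemLp f₁ ⊤ μ) (hf₂ : MemLp f₂ ⊤ μ)
    (c₁ c₂ : ℂ) :
    (memLp_prodComp h₁ h₂ hf₁ hf₂).toL2 = (memLp_prodComp h₁ h₂ (hf₁.sub_const c₁) hf₂).toL2
      + c₁ • (memLp_prodComp h₁ h₂ (memLp_const (1 : ℂ)) (hf₂.sub_const c₂)).toL2
      + (c₁ * c₂) • oneL2 ν := by
  have key := MemLp.toL2_congr (memLp_prodComp h₁ h₂ hf₁ hf₂)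
    (((memLp_prodComp h₁ h₂ (hf₁.sub_const c₁) hf₂).add
      ((memLp_prodComp h₁ h₂ (memLp_const (1 : ℂ)) (hf₂.sub_const c₂)).const_smul c₁)).add
      ((memLp_const (1 : ℂ)).const_smul (c₁ * c₂)))
    (Eventually.of_forall fun y => by
      simp only [Pi.add_apply, Pi.smul_apply, smul_eq_mul]
      ring)
  exact key

lemma integral_sub_integral {f : X → ℂ} (hf : MemLp f ⊤ μ) :
    ∫ x, (f x - ∫ y, f y ∂μ) ∂μ = 0 := by
  rw [integral_sub (hf.integrable le_top) (integrable_const _)]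
  simp

omit [IsProbabilityMeasure μ] in
lemma inner_prodComp {R₁ R₂ : Y → X} (h₁ : MeasurePreserving R₁ ν μ)
    (h₂ : MeasurePreserving R₂ ν μ) {f₁ f₂ g₁ g₂ : X → ℂ} (hf₁ : MemLp f₁ ⊤ μ)
    (hf₂ : MemLp f₂ ⊤ μ) (hg₁ : MemLp g₁ ⊤ μ) (hg₂ : MemLp g₂ ⊤ μ) :
    inner ℂ (memLp_prodComp h₁ h₂ hf₁ hf₂).toL2 (memLp_prodComp h₁ h₂ hg₁ hg₂).toL2
      = ∫ y, (fun x => star (f₁ x) * g₁ x) (R₁ y) * (fun x => star (f₂ x) * g₂ x) (R₂ y) ∂ν := by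
  rw [inner_toL2]
  refine integral_congr_ae (Eventually.of_forall fun y => ?_)
  simp only [star_mul']
  ring

omit [IsProbabilityMeasure μ] in
lemma MeasureTheory.MeasurePreserving.integral_comp_self {R : X → X} (hR : MeasurePreserving R μ μ)
    {F : X → ℂ} (hF : AEStronglyMeasurable F μ) : ∫ x, F (R x) ∂μ = ∫ x, F x ∂μ := by
  rw [← integral_map hR.measurable.aemeasurable (by rwa [hR.map_eq]), hR.map_eq]

omit [IsProbabilityMeasure μ] in
-- The change of variables `x ↦ T^b x`; it turns averages along `T₁ⁿ T₂^(-b(n))` into averages of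
-- joint products.
lemma integral_mul_comp_symm_iterate {T : X ≃ᵐ X} (hT : MeasurePreserving T μ μ) {Q : X → X}
    (hQ : MeasurePreserving Q μ μ) {f g : X → ℂ} (hf : MemLp f ⊤ μ) (hg : MemLp g ⊤ μ) (b : ℕ) :
    ∫ x, g x * f (Q (T.symm^[b] x)) ∂μ = ∫ x, g (T^[b] x) * f (Q x) ∂μ := by
  have hinv : ∀ x, T^[b] (T.symm^[b] x) = x :=
    (Function.LeftInverse.iterate (f := T.symm) (g := T) T.apply_symm_apply b)
  rw [← ((hT.symm T).iterate b).integral_comp_self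
    (memLp_prodComp (hT.iterate b) hQ hg hf).aestronglyMeasurable]
  simp only [hinv]

/-- The product of two transformations, acting on pairs indexed by `Fin 2`. -/
def pairMap (R R' : X → X) : (Fin 2 → X) → (Fin 2 → X) := fun x => ![R (x 0), R' (x 1)]

omit [MeasurableSpace X] in
lemma pairMap_comp (R R' Q Q' : X → X) :
    pairMap R R' ∘ pairMap Q Q' = pairMap (R ∘ Q) (R' ∘ Q') := rfl

omit [MeasurableSpace X] in
lemma pairMap_iterate (R R' : X → X) (n : ℕ) : (pairMap R R')^[n] = pairMap R^[n] R'^[n] := by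
  induction n with
  | zero =>
    funext x j
    fin_cases j <;> rfl
  | succ k ih => rw [Function.iterate_succ, ih, pairMap_comp]; rfl

lemma measurePreserving_pairMap {R R' : X → X} (hR : MeasurePreserving R μ μ)
    (hR' : MeasurePreserving R' μ μ) :
    MeasurePreserving (pairMap R R') (Measure.pi fun _ : Fin 2 => μ)
      (Measure.pi fun _ : Fin 2 => μ) := by
  have h := measurePreserving_pi (ι := Fin 2) (fun _ => μ) (fun _ => μ) (f := ![R, R'])
    (by intro i; fin_cases i; exacts [hR, hR'])
  convert h using 1
  funext x j
  fin_cases j <;> rfl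

/-- The tensor product of two bounded functions is bounded. -/
lemma memLp_tensor {f₁ f₂ : X → ℂ} (hf₁ : MemLp f₁ ⊤ μ) (hf₂ : MemLp f₂ ⊤ μ) :
    MemLp (fun x : Fin 2 → X => f₁ (x 0) * f₂ (x 1)) ⊤ (Measure.pi fun _ : Fin 2 => μ) :=
  memLp_prodComp (measurePreserving_eval (fun _ : Fin 2 => μ) 0)
    (measurePreserving_eval (fun _ : Fin 2 => μ) 1) hf₁ hf₂

lemma integral_tensor (f₁ f₂ : X → ℂ) :
    ∫ x : Fin 2 → X, f₁ (x 0) * f₂ (x 1) ∂(Measure.pi fun _ : Fin 2 => μ)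
      = (∫ x, f₁ x ∂μ) * ∫ x, f₂ x ∂μ := by
  have := integral_fintype_prod_eq_prod (𝕜 := ℂ) (μ := fun _ : Fin 2 => μ) ![f₁, f₂]
  simpa [Fin.prod_univ_two] using this

lemma inner_tensor {f₁ f₂ g₁ g₂ : X → ℂ} (hf₁ : MemLp f₁ ⊤ μ)
    (hf₂ : MemLp f₂ ⊤ μ) (hg₁ : MemLp g₁ ⊤ μ) (hg₂ : MemLp g₂ ⊤ μ) :
    inner ℂ (memLp_tensor hf₁ hf₂).toL2 (memLp_tensor hg₁ hg₂).toL2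
      = inner ℂ hf₁.toL2 hg₁.toL2 * inner ℂ hf₂.toL2 hg₂.toL2 := by
  refine (inner_prodComp (measurePreserving_eval (fun _ : Fin 2 => μ) 0)
    (measurePreserving_eval (fun _ : Fin 2 => μ) 1) hf₁ hf₂ hg₁ hg₂).trans ?_
  rw [inner_toL2, inner_toL2]
  exact integral_tensor (fun x => star (f₁ x) * g₁ x) (fun x => star (f₂ x) * g₂ x)

lemma koopman_pairMap_pow_tensor {R R' : X → X} (hR : MeasurePreserving R μ μ)
    (hR' : MeasurePreserving R' μ μ) {f₁ f₂ : X → ℂ} (hf₁ : MemLp f₁ ⊤ μ) (hf₂ : MemLp f₂ ⊤ μ)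
    (h : ℕ) : (koopman (measurePreserving_pairMap hR hR') ^ h) (memLp_tensor hf₁ hf₂).toL2
      = (memLp_tensor (hf₁.comp_measurePreserving (hR.iterate h))
          (hf₂.comp_measurePreserving (hR'.iterate h))).toL2 := by
  rw [← koopman_iterate, koopman_congr _ (measurePreserving_pairMap (hR.iterate h) (hR'.iterate h))
    (pairMap_iterate R R' h), koopman_toL2]
  rfl

/-- A square-integrable function on the product that is orthogonal to all tensor products
vanishes. -/
lemma eq_zero_of_inner_tensor (G : Lp ℂ 2 (Measure.pi fun _ : Fin 2 => μ))
    (hG : ∀ (f₁ f₂ : X → ℂ) (hf₁ : MemLp f₁ ⊤ μ) (hf₂ : MemLp f₂ ⊤ μ),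
      inner ℂ (memLp_tensor hf₁ hf₂).toL2 G = 0) : G = 0 := by
  have hint : Integrable G (Measure.pi fun _ : Fin 2 => μ) :=
    (Lp.memLp G).integrable (by norm_num)
  -- Tensors of indicators test `G` on boxes, and boxes are a π-system generating the product
  -- σ-algebra.
  have hbox : ∀ s : Fin 2 → Set X, (∀ i, MeasurableSet (s i)) →
      ∫ x in Set.univ.pi s, G x ∂(Measure.pi fun _ : Fin 2 => μ) = 0 := by
    intro s hs
    have hind : ∀ i, MemLp ((s i).indicator fun _ => (1 : ℂ)) ⊤ μ := fun i =>
      (memLp_const 1).indicator (hs i)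
    rw [← hG _ _ (hind 0) (hind 1), L2.inner_def,
      ← integral_indicator (MeasurableSet.univ_pi hs)]
    refine integral_congr_ae ?_
    filter_upwards [(memLp_tensor (hind 0) (hind 1)).coeFn_toL2] with x hx
    rw [hx, RCLike.inner_apply]
    by_cases h0 : x 0 ∈ s 0 <;> by_cases h1 : x 1 ∈ s 1 <;>
      simp [h0, h1, Set.indicator, Set.mem_pi, Fin.forall_fin_two]
  have hall : ∀ s, MeasurableSet s → ∫ x in s, G x ∂(Measure.pi fun _ : Fin 2 => μ) = 0 := by
    intro s hs
    refine MeasurableSpace.induction_on_inter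
      (C := fun s _ => ∫ x in s, G x ∂(Measure.pi fun _ : Fin 2 => μ) = 0)
      generateFrom_pi.symm isPiSystem_pi (by simp) ?_ ?_ ?_ s hs
    · rintro t ⟨u, hu, rfl⟩
      exact hbox u fun i => hu i (Set.mem_univ i)
    · intro t ht ih
      have htot := hbox (fun _ => Set.univ) fun _ => MeasurableSet.univ
      rw [Set.pi_univ, setIntegral_univ] at htot
      rw [setIntegral_compl ht hint, htot, ih, sub_zero]
    · intro t hd ht ih
      rw [integral_iUnion ht hd hint.integrableOn]
      simp [ih]
  have := hint.ae_eq_zero_of_forall_setIntegral_eq_zero fun s hs _ => hall s hs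
  exact (Lp.eq_zero_iff_ae_eq_zero).2 this

end Products

/-! ### The three ergodicity properties in terms of natural iterates. -/

section PairReformulation

variable {X : Type*} [MeasurableSpace X] {μ : Measure X} {T₁ T₂ : X ≃ᵐ X}

lemma transIter_natCast (T : X ≃ᵐ X) (n : ℕ) : transIter T n = T^[n] := by
  rw [transIter, zpow_natCast, ← Equiv.Perm.iterate_eq_pow]
  rfl

lemma transIter_neg_natCast (T : X ≃ᵐ X) (n : ℕ) : transIter T (-(n : ℤ)) = T.symm^[n] := by
  rw [transIter, zpow_neg, zpow_natCast, ← inv_pow, ← Equiv.Perm.iterate_eq_pow]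
  rfl

/-- This includes `n = 0`, where both logarithms have the default value `0`. -/
lemma floor_add_floor_logb (n : ℕ) :
    ⌊(n : ℝ) + (⌊Real.logb 2 (n : ℝ)⌋ : ℝ)⌋ = ((n + Nat.log 2 n : ℕ) : ℤ) := by
  have h : ⌊Real.logb 2 (n : ℝ)⌋ = (Nat.log 2 n : ℤ) := by
    have := Real.floor_logb_natCast (b := 2) (r := n) (by positivity)
    rw [Int.log_natCast] at this
    exact_mod_cast this
  rw [h]
  have : (n : ℝ) + ((Nat.log 2 n : ℤ) : ℝ) = ((n + Nat.log 2 n : ℕ) : ℝ) := by push_cast; ring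
  rw [this, Int.floor_natCast]

lemma stronglyJointlyErgodic_pair_iff :
    StronglyJointlyErgodic μ ![T₁, T₂]
        ![fun n => (n : ℝ), fun n => (n : ℝ) + (⌊Real.logb 2 (n : ℝ)⌋ : ℝ)] ↔
      ∀ f₁ f₂ : X → ℂ, MemLp f₁ ⊤ μ → MemLp f₂ ⊤ μ →
        StrongLimit μ (cesaroAvg fun n x => f₁ (T₁^[n] x) * f₂ (T₂^[n + Nat.log 2 n] x))
          ((∫ x, f₁ x ∂μ) * ∫ x, f₂ x ∂μ) := by
  have key : ∀ f : Fin 2 → X → ℂ,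
      StrongLimit μ (cesaroAvg fun n x => ∏ j, f j (transIter (![T₁, T₂] j)
        ⌊(![fun n => (n : ℝ), fun n => (n : ℝ) + (⌊Real.logb 2 (n : ℝ)⌋ : ℝ)] :
          Fin 2 → ℕ → ℝ) j n⌋ x)) (∏ j, ∫ x, f j x ∂μ) ↔
      StrongLimit μ (cesaroAvg fun n x => f 0 (T₁^[n] x) * f 1 (T₂^[n + Nat.log 2 n] x))
          ((∫ x, f 0 x ∂μ) * ∫ x, f 1 x ∂μ) := by
    intro f
    simp only [Fin.prod_univ_two, Matrix.cons_val_zero, Matrix.cons_val_one,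
      Int.floor_natCast, floor_add_floor_logb, transIter_natCast]
  constructor
  · intro h f₁ f₂ hf₁ hf₂
    exact (key ![f₁, f₂]).1 (h ![f₁, f₂] (by intro j; fin_cases j; exacts [hf₁, hf₂]))
  · intro h f hf
    exact (key f).2 (h _ _ (hf 0) (hf 1))

lemma weaklyDifferenceErgodic_pair_iff :
    WeaklyDifferenceErgodic μ ![T₁, T₂]
        ![fun n => (n : ℝ), fun n => (n : ℝ) + (⌊Real.logb 2 (n : ℝ)⌋ : ℝ)] ↔
      WeaklyErgodicSeq μ (fun n => T₁^[n] ∘ T₂.symm^[n + Nat.log 2 n]) ∧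
      WeaklyErgodicSeq μ (fun n => T₂^[n + Nat.log 2 n] ∘ T₁.symm^[n]) := by
  have h01 : (fun (n : ℕ) (x : X) => transIter T₁ ⌊(n : ℝ)⌋
      (transIter T₂ (-⌊(n : ℝ) + (⌊Real.logb 2 (n : ℝ)⌋ : ℝ)⌋) x))
      = fun n => T₁^[n] ∘ T₂.symm^[n + Nat.log 2 n] := by
    funext n x
    rw [floor_add_floor_logb, Int.floor_natCast, transIter_natCast, transIter_neg_natCast]
    rfl
  have h10 : (fun (n : ℕ) (x : X) => transIter T₂ ⌊(n : ℝ) + (⌊Real.logb 2 (n : ℝ)⌋ : ℝ)⌋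
      (transIter T₁ (-⌊(n : ℝ)⌋) x))
      = fun n => T₂^[n + Nat.log 2 n] ∘ T₁.symm^[n] := by
    funext n x
    rw [floor_add_floor_logb, Int.floor_natCast, transIter_natCast, transIter_neg_natCast]
    rfl
  rw [← h01, ← h10]
  constructor
  · intro h
    exact ⟨h 0 1 (by decide), h 1 0 (by decide)⟩
  · rintro ⟨h1, h2⟩ i j hij
    fin_cases i <;> fin_cases j
    · exact absurd rfl hij
    · exact h1
    · exact h2
    · exact absurd rfl hij

/-- Splitting `T₁ⁿ × T₂^(n + l)` as `(T₁ × T₂)ⁿ (id × T₂)^l` separates the linear part from the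
slowly varying one. -/
lemma stronglyProductErgodic_pair_iff :
    StronglyProductErgodic μ ![T₁, T₂]
        ![fun n => (n : ℝ), fun n => (n : ℝ) + (⌊Real.logb 2 (n : ℝ)⌋ : ℝ)] ↔
      StronglyErgodicSeq (Measure.pi fun _ : Fin 2 => μ)
        (fun n => (pairMap T₁ T₂)^[n] ∘ (pairMap id T₂)^[Nat.log 2 n]) := by
  have h : (fun (n : ℕ) (x : Fin 2 → X) (j : Fin 2) => transIter (![T₁, T₂] j)
        ⌊(![fun n => (n : ℝ), fun n => (n : ℝ) + (⌊Real.logb 2 (n : ℝ)⌋ : ℝ)] :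
          Fin 2 → ℕ → ℝ) j n⌋ (x j))
      = fun n => (pairMap T₁ T₂)^[n] ∘ (pairMap id T₂)^[Nat.log 2 n] := by
    funext n x j
    rw [pairMap_iterate, pairMap_iterate, pairMap_comp, ← Function.iterate_add, Function.iterate_id]
    fin_cases j
    · change transIter T₁ ⌊(n : ℝ)⌋ (x 0) = _
      rw [Int.floor_natCast, transIter_natCast]
      rfl
    · change transIter T₂ ⌊(n : ℝ) + (⌊Real.logb 2 (n : ℝ)⌋ : ℝ)⌋ (x 1) = _
      rw [floor_add_floor_logb, transIter_natCast]
      rfl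
  rw [StronglyProductErgodic, h]

end PairReformulation

/-! ### The two implications. -/

section Main

variable {X : Type*} [MeasurableSpace X] {μ : Measure X} [IsProbabilityMeasure μ]
  {T₁ T₂ : X ≃ᵐ X}

lemma commute_pairMap (hT₁ : MeasurePreserving T₁ μ μ) (hT₂ : MeasurePreserving T₂ μ μ) :
    Commute (koopman (measurePreserving_pairMap hT₁ hT₂))
      (koopman (measurePreserving_pairMap (MeasurePreserving.id μ) hT₂)) :=
  koopman_commute _ _ rfl

lemma koopman_iterate_comp_iterate {Y : Type*} [MeasurableSpace Y] {ν : Measure Y} {S V : Y → Y}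
    (hS : MeasurePreserving S ν ν) (hV : MeasurePreserving V ν ν)
    (hcomm : Commute (koopman hS) (koopman hV)) (n l : ℕ) :
    koopman ((hS.iterate n).comp (hV.iterate l)) = koopman hS ^ n * koopman hV ^ l := by
  rw [koopman_comp (hS.iterate n) (hV.iterate l), koopman_iterate hS, koopman_iterate hV,
    (hcomm.pow_pow n l).eq]

/-- The products `f₁(T₁ⁿ x) f₂(T₂^{n + ⌊log₂ n⌋} x)` as elements of `L²`. -/
noncomputable def jointTerm (hT₁ : MeasurePreserving T₁ μ μ) (hT₂ : MeasurePreserving T₂ μ μ)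
    {f₁ f₂ : X → ℂ} (hf₁ : MemLp f₁ ⊤ μ) (hf₂ : MemLp f₂ ⊤ μ) (n : ℕ) : Lp ℂ 2 μ :=
  (memLp_prodComp (hT₁.iterate n) (hT₂.iterate (n + Nat.log 2 n)) hf₁ hf₂).toL2

lemma stronglyJointlyErgodic_pair_iff_jointTerm (hT₁ : MeasurePreserving T₁ μ μ)
    (hT₂ : MeasurePreserving T₂ μ μ) :
    StronglyJointlyErgodic μ ![T₁, T₂]
        ![fun n => (n : ℝ), fun n => (n : ℝ) + (⌊Real.logb 2 (n : ℝ)⌋ : ℝ)] ↔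
      ∀ (f₁ f₂ : X → ℂ) (hf₁ : MemLp f₁ ⊤ μ) (hf₂ : MemLp f₂ ⊤ μ),
        Tendsto (cesaroMean (jointTerm hT₁ hT₂ hf₁ hf₂)) atTop
          (𝓝 (((∫ x, f₁ x ∂μ) * ∫ x, f₂ x ∂μ) • oneL2 μ)) := by
  rw [stronglyJointlyErgodic_pair_iff]
  refine forall_congr' fun f₁ => forall_congr' fun f₂ => forall_congr' fun hf₁ =>
    forall_congr' fun hf₂ => ?_
  exact strongLimit_iff (fun n => memLp_prodComp (hT₁.iterate n)
    (hT₂.iterate (n + Nat.log 2 n)) hf₁ hf₂) _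

/-- Weak difference ergodicity and ergodicity of the product imply that the averages of products
of functions with vanishing product of integrals tend to zero. -/
lemma tendsto_cesaroMean_jointTerm_zero (hT₁ : MeasurePreserving T₁ μ μ)
    (hT₂ : MeasurePreserving T₂ μ μ)
    (hWD : WeaklyErgodicSeq μ (fun n => T₁^[n] ∘ T₂.symm^[n + Nat.log 2 n]))
    (hinv : ∀ G, koopman (measurePreserving_pairMap hT₁ hT₂) G = G →
      G = inner ℂ (oneL2 (Measure.pi fun _ : Fin 2 => μ)) G • oneL2 _)
    {f₁ f₂ : X → ℂ} (hf₁ : MemLp f₁ ⊤ μ) (hf₂ : MemLp f₂ ⊤ μ)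
    (h0 : (∫ x, f₁ x ∂μ) * ∫ x, f₂ x ∂μ = 0) :
    Tendsto (cesaroMean (jointTerm hT₁ hT₂ hf₁ hf₂)) atTop (𝓝 0) := by
  obtain ⟨C₁, hC₁, hb₁⟩ := exists_ae_bound hf₁
  obtain ⟨C₂, hC₂, hb₂⟩ := exists_ae_bound hf₂
  have hbound : ∀ {R₁ R₂ : X → X} (h₁ : MeasurePreserving R₁ μ μ) (h₂ : MeasurePreserving R₂ μ μ),
      ‖(memLp_prodComp h₁ h₂ hf₁ hf₂).toL2‖ ≤ C₁ * C₂ := by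
    intro R₁ R₂ h₁ h₂
    refine norm_toL2_le _ (by positivity) ?_
    filter_upwards [h₁.quasiMeasurePreserving.ae hb₁, h₂.quasiMeasurePreserving.ae hb₂]
      with x hx hy
    rw [norm_mul]
    gcongr
  set S := koopman (measurePreserving_pairMap hT₁ hT₂) with hS
  set F := (memLp_tensor hf₁ hf₂).toL2 with hF
  -- `w n h` is the term at `n + h` with `log₂ (n + h)` replaced by `log₂ n`; it differs from the
  -- true term only near jumps.
  refine tendsto_cesaroMean_zero_of_correlations (C := C₁ * C₂)
    (w := fun n h => (memLp_prodComp (hT₁.iterate n) (hT₂.iterate (n + Nat.log 2 n))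
      (hf₁.comp_measurePreserving (hT₁.iterate h))
      (hf₂.comp_measurePreserving (hT₂.iterate h))).toL2)
    (z := fun h => (S ^ h) F) (fun n => hbound (hT₁.iterate n) (hT₂.iterate _)) (fun h => ?_) (fun h h' => ?_) ?_
  · have hw : ∀ n, (memLp_prodComp (hT₁.iterate n) (hT₂.iterate (n + Nat.log 2 n))
      (hf₁.comp_measurePreserving (hT₁.iterate h))
      (hf₂.comp_measurePreserving (hT₂.iterate h))).toL2
      = (memLp_prodComp (hT₁.iterate (n + h)) (hT₂.iterate (n + h + Nat.log 2 n)) hf₁ hf₂).toL2 := by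
      intro n
      refine MemLp.toL2_congr _ _ (Eventually.of_forall fun x => ?_)
      simp only [Function.comp_apply, ← Function.iterate_add_apply]
      rw [show h + n = n + h by ring, show h + (n + Nat.log 2 n) = n + h + Nat.log 2 n by ring]
    refine tendsto_cesaroMean_zero_of_le_log_shift (C := 2 * (C₁ * C₂)) (by positivity) h
      fun n _ => ?_
    rw [hw]
    rcases (Nat.log_mono_right (b := 2) (Nat.le_add_right n h)).eq_or_lt with hl | hl
    · have : jointTerm hT₁ hT₂ hf₁ hf₂ (n + h) = (memLp_prodComp (hT₁.iterate (n + h))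
          (hT₂.iterate (n + h + Nat.log 2 n)) hf₁ hf₂).toL2 :=
        MemLp.toL2_congr _ _ (Eventually.of_forall fun x => by rw [hl])
      rw [this, hl]
      simp
    · have h1 : (1 : ℝ) ≤ (Nat.log 2 (n + h) : ℝ) - Nat.log 2 n := by
        rw [le_sub_iff_add_le']
        exact_mod_cast hl
      calc _ ≤ C₁ * C₂ + C₁ * C₂ := (norm_sub_le _ _).trans (add_le_add
            (hbound (hT₁.iterate _) (hT₂.iterate _)) (hbound (hT₁.iterate _) (hT₂.iterate _)))
        _ = 2 * (C₁ * C₂) * 1 := by ring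
        _ ≤ _ := by gcongr
  -- The correlation is `∫ T₁ⁿ φ · T₂^b(n) ψ` with `φ = conj(T₁^h f₁) T₁^h' f₁` and `ψ` likewise.
  -- Its mean tends to `∫ φ ∫ ψ = ⟪S^h F, S^h' F⟫`.
  · simp only [hS, hF]
    rw [koopman_pairMap_pow_tensor hT₁ hT₂ hf₁ hf₂ h, koopman_pairMap_pow_tensor hT₁ hT₂ hf₁ hf₂ h',
      inner_tensor (hf₁.comp_measurePreserving (hT₁.iterate h))
        (hf₂.comp_measurePreserving (hT₂.iterate h)) (hf₁.comp_measurePreserving (hT₁.iterate h'))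
        (hf₂.comp_measurePreserving (hT₂.iterate h'))]
    have hφ := (hf₁.comp_measurePreserving (hT₁.iterate h)).star.mul (r := ⊤)
      (hf₁.comp_measurePreserving (hT₁.iterate h'))
    have hψ := (hf₂.comp_measurePreserving (hT₂.iterate h)).star.mul (r := ⊤)
      (hf₂.comp_measurePreserving (hT₂.iterate h'))
    have hlim := weaklyErgodicSeq_tendsto
      (fun n => (hT₁.iterate n).comp ((hT₂.symm T₂).iterate (n + Nat.log 2 n))) hWD hφ hψ
    rw [inner_toL2, inner_toL2, mul_comm]
    have e : ∀ (f g : X → ℂ), ∫ x, (g * star f) x ∂μ = ∫ x, star (f x) * g x ∂μ := fun f g =>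
      integral_congr_ae (Eventually.of_forall fun x => mul_comm _ _)
    rw [e, e] at hlim
    refine hlim.congr fun N => ?_
    congr 1
    funext n
    rw [inner_prodComp (hT₁.iterate n) (hT₂.iterate (n + Nat.log 2 n))
      (hf₁.comp_measurePreserving (hT₁.iterate h)) (hf₂.comp_measurePreserving (hT₂.iterate h))
      (hf₁.comp_measurePreserving (hT₁.iterate h')) (hf₂.comp_measurePreserving (hT₂.iterate h'))]
    refine (integral_mul_comp_symm_iterate hT₂ (hT₁.iterate n) hφ hψ (n + Nat.log 2 n)).trans ?_
    refine integral_congr_ae (Eventually.of_forall fun x => ?_)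
    simp only [Pi.mul_apply, Pi.star_apply, Function.comp_apply]
    ring
  · have := tendsto_averages_of_invariant (koopman_oneL2 _) hinv F
    rw [hF, inner_oneL2_toL2, integral_tensor, h0, zero_smul] at this
    exact this

/-- Weak difference ergodicity and ergodicity of the product imply joint ergodicity. -/
theorem tendsto_cesaroMean_jointTerm (hT₁ : MeasurePreserving T₁ μ μ)
    (hT₂ : MeasurePreserving T₂ μ μ)
    (hWD : WeaklyErgodicSeq μ (fun n => T₁^[n] ∘ T₂.symm^[n + Nat.log 2 n]))
    (hinv : ∀ G, koopman (measurePreserving_pairMap hT₁ hT₂) G = G →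
      G = inner ℂ (oneL2 (Measure.pi fun _ : Fin 2 => μ)) G • oneL2 _)
    {f₁ f₂ : X → ℂ} (hf₁ : MemLp f₁ ⊤ μ) (hf₂ : MemLp f₂ ⊤ μ) :
    Tendsto (cesaroMean (jointTerm hT₁ hT₂ hf₁ hf₂)) atTop
      (𝓝 (((∫ x, f₁ x ∂μ) * ∫ x, f₂ x ∂μ) • oneL2 μ)) := by
  set c₁ := ∫ x, f₁ x ∂μ with hc₁
  set c₂ := ∫ x, f₂ x ∂μ with hc₂
  have h1 := tendsto_cesaroMean_jointTerm_zero hT₁ hT₂ hWD hinv (hf₁.sub_const c₁) hf₂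
    (by rw [hc₁, integral_sub_integral hf₁, zero_mul])
  have h2 := tendsto_cesaroMean_jointTerm_zero hT₁ hT₂ hWD hinv (memLp_const (1 : ℂ))
    (hf₂.sub_const c₂) (by rw [hc₂, integral_sub_integral hf₂, mul_zero])
  have h3 := (h1.add (h2.const_smul c₁)).add (tendsto_cesaroMean_const ((c₁ * c₂) • oneL2 μ))
  rw [smul_zero, zero_add, zero_add] at h3
  refine h3.congr fun N => ?_
  rw [← cesaroMean_smul, ← cesaroMean_add, ← cesaroMean_add]
  congr 1
  funext n
  exact (prodComp_toL2_decomposition (hT₁.iterate n) (hT₂.iterate (n + Nat.log 2 n)) hf₁ hf₂ c₁ c₂).symm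

/-- Pairing the norm limit with the constant `1` gives convergence of the integrals of the products;
changing variables by `T₂` or by `T₁` gives the two differences. -/
lemma weaklyErgodicSeq_of_jointTerm (hT₁ : MeasurePreserving T₁ μ μ)
    (hT₂ : MeasurePreserving T₂ μ μ)
    (hSJ : ∀ (f₁ f₂ : X → ℂ) (hf₁ : MemLp f₁ ⊤ μ) (hf₂ : MemLp f₂ ⊤ μ),
        Tendsto (cesaroMean (jointTerm hT₁ hT₂ hf₁ hf₂)) atTop
          (𝓝 (((∫ x, f₁ x ∂μ) * ∫ x, f₂ x ∂μ) • oneL2 μ))) :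
    WeaklyErgodicSeq μ (fun n => T₁^[n] ∘ T₂.symm^[n + Nat.log 2 n]) ∧
      WeaklyErgodicSeq μ (fun n => T₂^[n + Nat.log 2 n] ∘ T₁.symm^[n]) := by
  have key : ∀ (f₁ f₂ : X → ℂ) (hf₁ : MemLp f₁ ⊤ μ) (hf₂ : MemLp f₂ ⊤ μ),
      Tendsto (cesaroMean fun n => ∫ x, f₁ (T₁^[n] x) * f₂ (T₂^[n + Nat.log 2 n] x) ∂μ) atTop
        (𝓝 ((∫ x, f₁ x ∂μ) * ∫ x, f₂ x ∂μ)) := by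
    intro f₁ f₂ hf₁ hf₂
    have h := ((innerSL ℂ (oneL2 μ)).continuous.tendsto _).comp (hSJ f₁ f₂ hf₁ hf₂)
    rw [map_smul, innerSL_apply_apply, inner_oneL2_self, smul_eq_mul, mul_one] at h
    refine h.congr fun N => ?_
    rw [Function.comp_apply, map_cesaroMean]
    congr 1
    funext n
    rw [innerSL_apply_apply, jointTerm, inner_oneL2_toL2]
  constructor
  · refine weaklyErgodicSeq_of_tendsto
      (fun n => (hT₁.iterate n).comp ((hT₂.symm T₂).iterate (n + Nat.log 2 n)))
      fun f g hf hg => ?_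
    rw [mul_comm]
    refine (key f g hf hg).congr fun N => ?_
    congr 1
    funext n
    refine Eq.trans ?_
      (integral_mul_comp_symm_iterate hT₂ (hT₁.iterate n) hf hg (n + Nat.log 2 n)).symm
    exact integral_congr_ae (Eventually.of_forall fun x => mul_comm _ _)
  · refine weaklyErgodicSeq_of_tendsto
      (fun n => (hT₂.iterate (n + Nat.log 2 n)).comp ((hT₁.symm T₁).iterate n))
      fun f g hf hg => ?_
    refine (key g f hg hf).congr fun N => ?_
    congr 1
    funext n
    exact (integral_mul_comp_symm_iterate hT₁ (hT₂.iterate (n + Nat.log 2 n)) hf hg n).symm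

/-- Taking one function equal to `1` leaves averages of a single transformation, which do not move
its invariant vectors. -/
lemma ergodic_of_jointTerm (hT₁ : MeasurePreserving T₁ μ μ) (hT₂ : MeasurePreserving T₂ μ μ)
    (hSJ : ∀ (f₁ f₂ : X → ℂ) (hf₁ : MemLp f₁ ⊤ μ) (hf₂ : MemLp f₂ ⊤ μ),
        Tendsto (cesaroMean (jointTerm hT₁ hT₂ hf₁ hf₂)) atTop
          (𝓝 (((∫ x, f₁ x ∂μ) * ∫ x, f₂ x ∂μ) • oneL2 μ))) :
    (∀ x, koopman hT₁ x = x → x = inner ℂ (oneL2 μ) x • oneL2 μ) ∧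
      ∀ x, koopman hT₂ x = x → x = inner ℂ (oneL2 μ) x • oneL2 μ := by
  have hone : MemLp (fun _ : X => (1 : ℂ)) ⊤ μ := memLp_const 1
  constructor
  · have herg : StronglyErgodicSeq μ fun n => T₁^[n] := by
      intro f hf
      refine (strongLimit_iff (fun n => hf.comp_measurePreserving (hT₁.iterate n)) _).2 ?_
      have h := hSJ f _ hf hone
      rw [integral_const, probReal_univ, one_smul, mul_one] at h
      refine h.congr fun N => ?_
      congr 1
      funext n
      exact MemLp.toL2_congr _ _ (Eventually.of_forall fun x => mul_one _)
    intro x hx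
    have h := (stronglyErgodicSeq_iff fun n => hT₁.iterate n).1 herg x
    refine tendsto_nhds_unique (tendsto_cesaroMean_const x) (h.congr fun N => ?_)
    congr 1
    funext n
    rw [koopman_iterate hT₁, LinearIsometry.pow_apply_eq_self hx]
  · have herg : StronglyErgodicSeq μ fun n => T₂^[n + Nat.log 2 n] := by
      intro f hf
      refine (strongLimit_iff
        (fun n => hf.comp_measurePreserving (hT₂.iterate (n + Nat.log 2 n))) _).2 ?_
      have h := hSJ _ f hone hf
      rw [integral_const, probReal_univ, one_smul, one_mul] at h
      refine h.congr fun N => ?_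
      congr 1
      funext n
      exact MemLp.toL2_congr _ _ (Eventually.of_forall fun x => one_mul _)
    intro x hx
    have h := (stronglyErgodicSeq_iff fun n => hT₂.iterate (n + Nat.log 2 n)).1 herg x
    refine tendsto_nhds_unique (tendsto_cesaroMean_const x) (h.congr fun N => ?_)
    congr 1
    funext n
    rw [koopman_iterate hT₂, LinearIsometry.pow_apply_eq_self hx]

/-- Eigenfunctions of an ergodic transformation have constant modulus. -/
lemma exists_ae_norm_eq_of_eigenvector {T : X → X} (hT : MeasurePreserving T μ μ)
    (hinv : ∀ x, koopman hT x = x → x = inner ℂ (oneL2 μ) x • oneL2 μ) {e : Lp ℂ 2 μ} {c : ℂ}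
    (hc : ‖c‖ = 1) (he : koopman hT e = c • e) : ∃ k : ℝ, ∀ᵐ x ∂μ, ‖e x‖ = k := by
  -- As `|c| = 1`, the modulus of `e` is invariant, hence constant by ergodicity.
  have hmem : MemLp (fun x => ((‖e x‖ : ℝ) : ℂ)) 2 μ := (Lp.memLp e).norm.ofReal
  have hfix : koopman hT (hmem.toLp _) = hmem.toLp _ := by
    rw [koopman_toLp]
    refine MemLp.toLp_congr _ _ ?_
    have h1 := koopman_coeFn hT e
    rw [he] at h1
    filter_upwards [h1, Lp.coeFn_smul c e] with x hx hy
    rw [Function.comp_apply] at hx ⊢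
    rw [← hx, hy, Pi.smul_apply, norm_smul, hc, one_mul]
  have h2 := hinv _ hfix
  refine ⟨(inner ℂ (oneL2 μ) (hmem.toLp _)).re, ?_⟩
  have h3 := hmem.coeFn_toLp
  rw [h2] at h3
  filter_upwards [h3, smul_oneL2_coeFn (ν := μ) (inner ℂ (oneL2 μ) (hmem.toLp _))] with x hx hy
  rw [hy] at hx
  rw [hx, Complex.ofReal_re]

omit [IsProbabilityMeasure μ] in
lemma ae_iterate_eigenvector {T : X → X} (hT : MeasurePreserving T μ μ) {e : Lp ℂ 2 μ} {c : ℂ}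
    (he : koopman hT e = c • e) (n : ℕ) : ∀ᵐ x ∂μ, e (T^[n] x) = c ^ n * e x := by
  have hpow : koopman (hT.iterate n) e = c ^ n • e := by
    rw [koopman_iterate hT]
    induction n with
    | zero => simp
    | succ k ih => rw [pow_succ', LinearIsometry.mul_apply', ih, map_smul, he, smul_smul, pow_succ]
  have h1 := koopman_coeFn (hT.iterate n) e
  rw [hpow] at h1
  filter_upwards [h1, Lp.coeFn_smul (c ^ n) e] with x hx hy
  rw [Function.comp_apply] at hx
  rw [← hx, hy, Pi.smul_apply, smul_eq_mul]

/-- Joint ergodicity excludes eigenvalues other than one that are inverse to each other. -/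
lemma eq_one_of_eigenvectors (hT₁ : MeasurePreserving T₁ μ μ) (hT₂ : MeasurePreserving T₂ μ μ)
    (hSJ : ∀ (f₁ f₂ : X → ℂ) (hf₁ : MemLp f₁ ⊤ μ) (hf₂ : MemLp f₂ ⊤ μ),
        Tendsto (cesaroMean (jointTerm hT₁ hT₂ hf₁ hf₂)) atTop
          (𝓝 (((∫ x, f₁ x ∂μ) * ∫ x, f₂ x ∂μ) • oneL2 μ)))
    {c : ℂ} (hc : ‖c‖ = 1) {e₁ e₂ : Lp ℂ 2 μ} (he₁ : koopman hT₁ e₁ = c⁻¹ • e₁)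
    (he₂ : koopman hT₂ e₂ = c • e₂) (h₁ : e₁ ≠ 0) (h₂ : e₂ ≠ 0) : c = 1 := by
  by_contra hc1
  obtain ⟨hinv₁, hinv₂⟩ := ergodic_of_jointTerm hT₁ hT₂ hSJ
  have hc0 : c ≠ 0 := by
    rintro rfl
    simp at hc
  obtain ⟨k₁, hk₁⟩ := exists_ae_norm_eq_of_eigenvector hT₁ hinv₁ (by rw [norm_inv, hc, inv_one]) he₁
  obtain ⟨k₂, hk₂⟩ := exists_ae_norm_eq_of_eigenvector hT₂ hinv₂ hc he₂
  have hne : ∀ (e : Lp ℂ 2 μ) (k : ℝ), e ≠ 0 → (∀ᵐ x ∂μ, ‖e x‖ = k) → k ≠ 0 := by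
    rintro e k he hk rfl
    refine he ((Lp.eq_zero_iff_ae_eq_zero).2 ?_)
    filter_upwards [hk] with x hx
    exact norm_eq_zero.1 hx
  have hk₁0 := hne e₁ k₁ h₁ hk₁
  have hk₂0 := hne e₂ k₂ h₂ hk₂
  -- Constant modulus makes the eigenfunctions bounded, so joint ergodicity applies to them.
  have hm₁ : MemLp e₁ ⊤ μ :=
    memLp_top_of_bound (Lp.aestronglyMeasurable e₁) k₁ (hk₁.mono fun x hx => hx.le)
  have hm₂ : MemLp e₂ ⊤ μ :=
    memLp_top_of_bound (Lp.aestronglyMeasurable e₂) k₂ (hk₂.mono fun x hx => hx.le)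
  have hint : ∫ x, e₁ x ∂μ = 0 := by
    have h := (koopman hT₁).inner_map_map (oneL2 μ) e₁
    rw [koopman_oneL2, he₁, inner_smul_right, inner_oneL2] at h
    by_contra h0
    exact hc1 (inv_eq_one.1 (mul_eq_right₀ h0 |>.1 h))
  have hlim := hSJ e₁ e₂ hm₁ hm₂
  rw [hint, zero_mul, zero_smul] at hlim
  have hprod : MemLp (fun x => e₁ x * e₂ x) ⊤ μ :=
    memLp_prodComp (MeasurePreserving.id μ) (MeasurePreserving.id μ) hm₁ hm₂
  -- The linear parts `c⁻ⁿ` and `cⁿ` cancel. What remains is constant on dyadic blocks with constant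
  -- norm, so averages tending to zero would force `e₁ e₂ = 0`.
  have hterm : jointTerm hT₁ hT₂ hm₁ hm₂ = fun n => c ^ Nat.log 2 n • hprod.toL2 := by
    funext n
    refine (MemLp.toL2_congr _ (hprod.const_smul (c ^ Nat.log 2 n)) ?_ :)
    filter_upwards [ae_iterate_eigenvector hT₁ he₁ n,
      ae_iterate_eigenvector hT₂ he₂ (n + Nat.log 2 n)] with x hx hy
    rw [hx, hy, Pi.smul_apply, smul_eq_mul, pow_add, inv_pow]
    field_simp
  rw [hterm] at hlim
  have hnorm := (tendsto_zero_of_cesaroMean_log (v := fun k => c ^ k • hprod.toL2) hlim).norm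
  simp only [norm_smul, norm_pow, hc, one_pow, one_mul, norm_zero] at hnorm
  have hzero : hprod.toL2 = 0 :=
    norm_eq_zero.1 (tendsto_nhds_unique hnorm tendsto_const_nhds).symm
  have hae := hprod.coeFn_toL2
  rw [hzero] at hae
  have : ∀ᵐ x ∂μ, False := by
    filter_upwards [hae, Lp.coeFn_zero ℂ 2 μ, hk₁, hk₂] with x hx h0 hx₁ hx₂
    rw [h0, Pi.zero_apply] at hx
    rcases mul_eq_zero.1 hx.symm with h | h
    · exact hk₁0 (by rw [← hx₁, h, norm_zero])
    · exact hk₂0 (by rw [← hx₂, h, norm_zero])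
  exact this.exists.elim fun _ h => h

/-- Joint ergodicity implies ergodicity of the product transformation. -/
theorem invariant_pairMap_of_jointTerm (hT₁ : MeasurePreserving T₁ μ μ)
    (hT₂ : MeasurePreserving T₂ μ μ)
    (hSJ : ∀ (f₁ f₂ : X → ℂ) (hf₁ : MemLp f₁ ⊤ μ) (hf₂ : MemLp f₂ ⊤ μ),
        Tendsto (cesaroMean (jointTerm hT₁ hT₂ hf₁ hf₂)) atTop
          (𝓝 (((∫ x, f₁ x ∂μ) * ∫ x, f₂ x ∂μ) • oneL2 μ)))
    (G : Lp ℂ 2 (Measure.pi fun _ : Fin 2 => μ))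
    (hG : koopman (measurePreserving_pairMap hT₁ hT₂) G = G) :
    G = inner ℂ (oneL2 (Measure.pi fun _ : Fin 2 => μ)) G • oneL2 _ := by
  obtain ⟨hinv₁, hinv₂⟩ := ergodic_of_jointTerm hT₁ hT₂ hSJ
  set S := koopman (measurePreserving_pairMap hT₁ hT₂) with hS
  -- For the projection `p` of the tensor `F` to the invariant vectors, `‖p‖² = ⟪F, p⟫` is the limit
  -- of averaged products of autocorrelations of `f₁` and `f₂`, to which Wiener's lemma applies.
  have hzero : ∀ (f₁ f₂ : X → ℂ) (hf₁ : MemLp f₁ ⊤ μ) (hf₂ : MemLp f₂ ⊤ μ),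
      (∫ x, f₁ x ∂μ) * ∫ x, f₂ x ∂μ = 0 → ∀ K, S K = K →
      inner ℂ K (memLp_tensor hf₁ hf₂).toL2 = 0 := by
    intro f₁ f₂ hf₁ hf₂ h0 K hK
    set F := (memLp_tensor hf₁ hf₂).toL2 with hF
    obtain ⟨p, hp, hlim, hinner⟩ := S.exists_tendsto_averages F
    have hlim' := ((innerSL ℂ F).continuous.tendsto _).comp hlim
    have hcorr : Tendsto (fun N : ℕ => (N : ℂ)⁻¹ * ∑ h ∈ Finset.range N,
        inner ℂ hf₁.toL2 (((koopmanEquiv T₁ hT₁).toLinearIsometry ^ h) hf₁.toL2) *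
        inner ℂ hf₂.toL2 (((koopmanEquiv T₂ hT₂).toLinearIsometry ^ h) hf₂.toL2)) atTop
        (𝓝 (inner ℂ F p)) := by
      refine hlim'.congr fun N => ?_
      rw [Function.comp_apply, innerSL_apply_apply, inner_smul_right, inner_sum]
      congr 1
      refine Finset.sum_congr rfl fun h _ => ?_
      rw [hF, hS, koopman_pairMap_pow_tensor hT₁ hT₂ hf₁ hf₂ h, inner_tensor,
        koopmanEquiv_toLinearIsometry, koopmanEquiv_toLinearIsometry, ← koopman_iterate hT₁,
        ← koopman_iterate hT₂, koopman_toL2, koopman_toL2]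
    have hp0 : inner ℂ F p = 0 := by
      by_contra hne
      obtain ⟨c, hc, e₁, e₂, he₁, he₂, hi₁, hi₂⟩ :=
        exists_eigenvectors_of_correlations _ _ _ _ hcorr hne
      have hc1 := eq_one_of_eigenvectors hT₁ hT₂ hSJ hc he₁ he₂
        (by rintro rfl; simp at hi₁) (by rintro rfl; simp at hi₂)
      rw [hc1, inv_one, one_smul] at he₁
      rw [hc1, one_smul] at he₂
      -- With `c = 1` the eigenvectors are constants by ergodicity, so a function not orthogonal to
      -- one has nonzero integral; this contradicts `h0`.
      have hne0 : ∀ (f : X → ℂ) (hf : MemLp f ⊤ μ) (e : Lp ℂ 2 μ),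
          e = inner ℂ (oneL2 μ) e • oneL2 μ → inner ℂ hf.toL2 e ≠ 0 → ∫ x, f x ∂μ ≠ 0 := by
        intro f hf e he hi h
        apply hi
        rw [he, inner_smul_right, ← inner_conj_symm hf.toL2, inner_oneL2_toL2, h]
        simp
      exact mul_ne_zero (hne0 f₁ hf₁ e₁ (hinv₁ e₁ he₁) hi₁) (hne0 f₂ hf₂ e₂ (hinv₂ e₂ he₂) hi₂) h0
    have hpp : inner ℂ p p = 0 := by
      rw [hinner p hp, ← inner_conj_symm, hp0, map_zero]
    rw [← hinner K hK, inner_self_eq_zero.1 hpp, inner_zero_right]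
  rw [← sub_eq_zero]
  -- `K` is invariant and orthogonal to constants, hence orthogonal to every term in the
  -- decomposition of a tensor.
  set K := G - inner ℂ (oneL2 (Measure.pi fun _ : Fin 2 => μ)) G • oneL2 _ with hKdef
  have hK : S K = K := by
    rw [hKdef, map_sub, map_smul, hG, hS, koopman_oneL2]
  have hK1 : inner ℂ K (oneL2 (Measure.pi fun _ : Fin 2 => μ)) = 0 := by
    rw [← inner_conj_symm, hKdef, inner_sub_right, inner_smul_right, inner_oneL2_self]
    simp
  refine eq_zero_of_inner_tensor K fun f₁ f₂ hf₁ hf₂ => ?_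
  rw [← inner_conj_symm]
  have hdec : (memLp_tensor hf₁ hf₂).toL2 = _ :=
    prodComp_toL2_decomposition (measurePreserving_eval (fun _ : Fin 2 => μ) 0)
      (measurePreserving_eval (fun _ : Fin 2 => μ) 1) hf₁ hf₂ (∫ x, f₁ x ∂μ) (∫ x, f₂ x ∂μ)
  have z1 := hzero _ _ (hf₁.sub_const (∫ x, f₁ x ∂μ)) hf₂
    (by rw [integral_sub_integral hf₁, zero_mul]) K hK
  have z2 := hzero _ _ (memLp_const (1 : ℂ)) (hf₂.sub_const (∫ x, f₂ x ∂μ))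
    (by rw [integral_sub_integral hf₂, mul_zero]) K hK
  rw [hdec, inner_add_right, inner_add_right, inner_smul_right, inner_smul_right, hK1]
  erw [z1, z2]
  simp

end Main

theorem proposition8p6 {X : Type*} [MeasurableSpace X] (μ : Measure X) [IsProbabilityMeasure μ]
    (T₁ T₂ : X ≃ᵐ X) (hT₁ : MeasurePreserving T₁ μ μ) (hT₂ : MeasurePreserving T₂ μ μ)
    (hcomm : ∀ᵐ x ∂μ, T₁ (T₂ x) = T₂ (T₁ x)) :
    (WeaklyDifferenceErgodic μ ![T₁, T₂]
        ![fun n => (n : ℝ), fun n => (n : ℝ) + (⌊Real.logb 2 (n : ℝ)⌋ : ℝ)] ∧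
      StronglyProductErgodic μ ![T₁, T₂]
        ![fun n => (n : ℝ), fun n => (n : ℝ) + (⌊Real.logb 2 (n : ℝ)⌋ : ℝ)]) ↔
      StronglyJointlyErgodic μ ![T₁, T₂]
        ![fun n => (n : ℝ), fun n => (n : ℝ) + (⌊Real.logb 2 (n : ℝ)⌋ : ℝ)] := by
  have hS := measurePreserving_pairMap hT₁ hT₂
  have hV := measurePreserving_pairMap (MeasurePreserving.id μ) hT₂
  have hSV := commute_pairMap hT₁ hT₂
  rw [stronglyJointlyErgodic_pair_iff_jointTerm hT₁ hT₂, weaklyDifferenceErgodic_pair_iff,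
    stronglyProductErgodic_pair_iff,
    stronglyErgodicSeq_iff fun n => (hS.iterate n).comp (hV.iterate (Nat.log 2 n))]
  simp only [koopman_iterate_comp_iterate hS hV hSV]
  constructor
  · rintro ⟨⟨hWD, -⟩, hSP⟩ f₁ f₂ hf₁ hf₂
    refine tendsto_cesaroMean_jointTerm hT₁ hT₂ hWD (fun G hG => ?_) hf₁ hf₂
    -- Strong product ergodicity enters only through ergodicity of `T₁ × T₂`; the limit is a
    -- constant, hence fixed by `id × T₂`.
    exact eq_of_tendsto_cesaroMean_log hSV hG (by rw [map_smul, koopman_oneL2]) (hSP G)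
  · intro hSJ
    exact ⟨weaklyErgodicSeq_of_jointTerm hT₁ hT₂ hSJ,
      tendsto_cesaroMean_log_of_invariant hSV (koopman_oneL2 _) (koopman_oneL2 _)
        (invariant_pairMap_of_jointTerm hT₁ hT₂ hSJ)⟩
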